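/- Let $X=(a_1,\dots,a_N)$ be a finite list of vectors spanning $V=\mathbb R^s$ (repetitions allowed) such that $0$ is not in the convex hull of the $a_i$. For vectors $v_1,\dots,v_k$ put $C(v_1,\dots,v_k)=\{\sum_i t_iv_i : t_i\ge 0\}$, and write $C(X)$ for the cone of the list $X$. The multivariate spline $T_X:V\to\mathbb R$ is the function that vanishes outside $C(X)$, is continuous on $C(X)$, and satisfies $$\int_{V} f(x)\,T_X(x)\,dx=\int_{\mathbb R_{\ge 0}^N} f\Big(\sum_{i=1}^N t_ia_i\Big)\,dt$$ for every continuous function $f$ on $V$ with compact support. A basis $\underline b=(a_{i_1},\dots,a_{i_s})$, $i_1<\dots<i_s$, extracted from $X$ is *no broken* if the only indices $i$ for which there is $e$ with $i\le i_e$ and $a_i\in\mathrm{span}(a_{i_e},\dots,a_{i_s})$ are $i_1,\dots,i_s$ themselves. Let $\mathcal{NB}$ be the set of no broken bases. The *regular points* are the points of $C(X)$ lying on the boundary of no cone $C(\underline b)$, $\underline b\in\mathcal{NB}$; the *big cells* are the connected components of the set of regular points. A sublist $Y$ of $X$ is a *cocircuit* if $X\setminus Y$ does not span $V$, and $D(X)$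 is the space of real polynomials $p$ on $V$ with $\prod_{a\in Y}D_a\,p=0$ for all cocircuits $Y$, where $D_a$ is the directional derivative. On the dual space $U=V^*$ put $d_X=\prod_{a\in X}a$ and $d_{\underline b}=\prod_{a\in\underline b}a$ (products of linear forms), and for a polynomial $p$ on $V$ let $p(\partial)$ be the constant coefficient differential operator on $U$ obtained by letting the coordinate $x_j$ act as $\partial/\partial u_j$. **Theorem.** The function $T_X$ exists and is unique, and there is a family of real polynomials $(p_{\underline b,X})_{\underline b\in\mathcal{NB}}$ on $V$ such that: 1. each $p_{\underline b,X}$ is homogeneous of degree $N-s$ and lies in $D(X)$; 2. as rational functions on $U$, $$\frac1{d_X}=\sum_{\underline b\in\mathcal{NB}}p_{\underline b,X}(\partial)\,\frac1{d_{\underline b}},$$ and $(p_{\underline b,X})$ is the only family of real polynomials indexed by $\mathcal{NB}$ with this property; 3. for every big cell $\mathfrak c$ and every $x$ in the closure of $\mathfrak c$, $$T_X(x)=\sum_{\underline b\in\mathcal{NB},\ \mathfrak c\subset C(\underline b)}|\det(\underline b)|^{-1}\,p_{\underline b,X}(-x),$$ and $(p_{\underline b,X})$ is the only family of real polynomials indexed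 by $\mathcal{NB}$ for which this holds for all big cells $\mathfrak c$ and all $x\in\overline{\mathfrak c}$. -/

import Mathlib

noncomputable section

open scoped Classical

namespace Spline

/- Throughout, `V = ℝ^s` is `Fin s → ℝ` with standard Lebesgue measure, its dual `U` is identified
with `Fin s → ℝ` through the dot product, and the list `X = (a_0, …, a_{N-1})` is a family
`a : Fin N → Fin s → ℝ` (repetitions are allowed; sublists are sublists of indices). -/

/-- The closed cone of all nonnegative linear combinations of a finite family of vectors. -/
def cone {ι : Type*} [Fintype ι] {s : ℕ} (v : ι → Fin s → ℝ) : Set (Fin s → ℝ) :=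
  {x | ∃ t : ι → ℝ, (∀ i, 0 ≤ t i) ∧ x = ∑ i, t i • v i}

/-- `T` is the multivariate spline `T_X`: the function supported in `C(X)`, continuous on `C(X)`,
with `∫_V f T_X = ∫_{ℝ_+^N} f (∑ tᵢ aᵢ) dt` for all continuous `f` with compact support. -/
structure IsMultivariateSpline {s N : ℕ} (a : Fin N → Fin s → ℝ) (T : (Fin s → ℝ) → ℝ) :
    Prop where
  eq_zero_of_notMem : ∀ x, x ∉ cone a → T x = 0
  continuousOn : ContinuousOn T (cone a)
  integral_eq : ∀ f : (Fin s → ℝ) → ℝ, Continuous f → HasCompactSupport f →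
    ∫ x, f x * T x = ∫ t in {t : Fin N → ℝ | ∀ i, 0 ≤ t i}, f (∑ i, t i • a i)

/-- The element `a_i` breaks the sublist `a_{c 0}, …, a_{c (k-1)}` (for `c` strictly increasing):
for some `e`, `i ≤ c e` and `a_i` is linearly dependent on `a_{c e}, …, a_{c (k-1)}`. -/
def Breaks {s N k : ℕ} (a : Fin N → Fin s → ℝ) (c : Fin k ↪o Fin N) (i : Fin N) : Prop :=
  ∃ e : Fin k, i ≤ c e ∧ a i ∈ Submodule.span ℝ ((fun j => a (c j)) '' Set.Ici e)

/-- The no broken bases extracted from `X`: the sublists of `s` linearly independent elements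
that are broken only by their own elements. -/
def NB {s N : ℕ} (a : Fin N → Fin s → ℝ) : Type :=
  {b : Fin s ↪o Fin N //
    LinearIndependent ℝ (fun j => a (b j)) ∧ {i | Breaks a b i} = Set.range b}

/-- The vectors of a no broken basis. -/
def NB.vec {s N : ℕ} {a : Fin N → Fin s → ℝ} (b : NB a) : Fin s → Fin s → ℝ :=
  fun j => a (b.1 j)

instance {s N : ℕ} (a : Fin N → Fin s → ℝ) : Finite (NB a) :=
  Finite.of_injective (fun b : NB a => (fun j => b.1 j : Fin s → Fin N)) (by
    intro b c h
    apply Subtype.ext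
    apply DFunLike.ext
    intro j
    exact congrFun h j)

instance {s N : ℕ} (a : Fin N → Fin s → ℝ) : Fintype (NB a) := Fintype.ofFinite _

/-- The regular points of `C(X)`: those on the boundary of no cone `C(b)`, `b` no broken. -/
def regularPoints {s N : ℕ} (a : Fin N → Fin s → ℝ) : Set (Fin s → ℝ) :=
  cone a \ ⋃ b : NB a, frontier (cone b.vec)

/-- The big cells: the connected components of the set of regular points. -/
def IsBigCell {s N : ℕ} (a : Fin N → Fin s → ℝ) (c : Set (Fin s → ℝ)) : Prop :=
  ∃ x ∈ regularPoints a, c = connectedComponentIn (regularPoints a) x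

/-- A sublist `Y` of `X` is a cocircuit if the elements of `X - Y` do not span `V`. -/
def IsCocircuit {s N : ℕ} (a : Fin N → Fin s → ℝ) (Y : Finset (Fin N)) : Prop :=
  Submodule.span ℝ (a '' {i | i ∉ Y}) ≠ ⊤

/-- The directional derivative `D_v` on polynomials on `V`: the derivation with `D_v x_j = v_j`. -/
def dirDeriv {s : ℕ} (v : Fin s → ℝ) : Module.End ℝ (MvPolynomial (Fin s) ℝ) :=
  (MvPolynomial.mkDerivation ℝ (fun j => MvPolynomial.C (v j))).toLinearMap

/-- `D_Y = ∏_{i ∈ Y} D_{a_i}` (the factors commute). -/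
def dirDerivProd {s N : ℕ} (a : Fin N → Fin s → ℝ) (Y : Finset (Fin N)) :
    Module.End ℝ (MvPolynomial (Fin s) ℝ) :=
  (((List.finRange N).filter (fun i => i ∈ Y)).map (fun i => dirDeriv (a i))).prod

/-- The space `D(X)` of polynomials on `V` killed by `D_Y` for every cocircuit `Y`. -/
def spaceD {s N : ℕ} (a : Fin N → Fin s → ℝ) : Submodule ℝ (MvPolynomial (Fin s) ℝ) :=
  ⨅ (Y : Finset (Fin N)) (_ : IsCocircuit a Y), LinearMap.ker (dirDerivProd a Y)

/-- The partial derivative `∂/∂u_j` of a function on `U`. -/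
def partialD {s : ℕ} (j : Fin s) (f : (Fin s → ℝ) → ℝ) : (Fin s → ℝ) → ℝ :=
  fun u => fderiv ℝ f u (Pi.single j 1)

/-- The iterated partial derivative `∂_0^{m_0} ⋯ ∂_{s-1}^{m_{s-1}} f`. -/
def iterPartialD {s : ℕ} (m : Fin s →₀ ℕ) (f : (Fin s → ℝ) → ℝ) : (Fin s → ℝ) → ℝ :=
  (List.finRange s).foldr (fun j g => (partialD j)^[m j] g) f

/-- `p(∂) f`, where a polynomial `p` on `V` acts on functions on `U` as a differential operator
with constant coefficients, `x_j` acting as `∂/∂u_j`. -/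
def polyDiff {s : ℕ} (p : MvPolynomial (Fin s) ℝ) (f : (Fin s → ℝ) → ℝ) (u : Fin s → ℝ) : ℝ :=
  ∑ m ∈ p.support, p.coeff m * iterPartialD m f u

/-- The product of the linear forms on `U` given by a finite family of vectors of `V`. -/
def dProd {ι : Type*} [Fintype ι] {s : ℕ} (v : ι → Fin s → ℝ) (u : Fin s → ℝ) : ℝ :=
  ∏ i, v i ⬝ᵥ u

/-- `1/d_X = ∑_b p_b(∂)(1/d_b)`, an identity of rational functions, i.e. of functions on the
complement in `U` of the hyperplanes `a_i = 0`. -/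
def IsPartialFractionExpansion {s N : ℕ} (a : Fin N → Fin s → ℝ)
    (p : NB a → MvPolynomial (Fin s) ℝ) : Prop :=
  ∀ u : Fin s → ℝ, (∀ i, a i ⬝ᵥ u ≠ 0) →
    (dProd a u)⁻¹ = ∑ b : NB a, polyDiff (p b) (fun w => (dProd b.vec w)⁻¹) u

/-- On the closure of every big cell `c`,
`T(x) = ∑_{b : c ⊆ C(b)} |det b|⁻¹ p_b(-x)`. -/
def IsLocalExpansion {s N : ℕ} (a : Fin N → Fin s → ℝ) (T : (Fin s → ℝ) → ℝ)
    (p : NB a → MvPolynomial (Fin s) ℝ) : Prop :=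
  ∀ c : Set (Fin s → ℝ), IsBigCell a c → ∀ x ∈ closure c,
    T x = ∑ b : NB a with c ⊆ cone b.vec,
      |(Matrix.of b.vec).det|⁻¹ * MvPolynomial.eval (-x) (p b)

end Spline

end

/-! The bridge is the Laplace transform. For `u` positive on all the `a i`, the transform of `T_X`
at `u` is `1/d_X`, because the integral over the orthant factors; the transform of `|det b|⁻¹ p(-x)`
on the cone of a basis `b` is `p(∂)(1/d_b)`, as seen in the coordinates of `b`. Since the transform
is injective on functions supported in the pointed cone (`ae_eq_zero_of_laplace_eq_zero`, by
Stone–Weierstrass for exponentials), a partial fraction expansion and a piecewise polynomial formula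
for `T_X` carry the same information.

The expansion exists (`exists_partialFraction`) because a relation expressing `a i` through later `a
j` trades a power of some `1/a j` for one of `1/a i`; the process can only stop when the denominator
is supported on a no broken basis.

For uniqueness, fix `b` and expand rational functions as iterated Laurent series in the coordinates
of `b`, earlier coordinates dominating later ones. The monomials with a pole in every coordinate
determine `p b`. The summand of `c ≠ b` contains no such monomial, since some coordinate of `b`
leads no vector of `c` (`exists_forall_not_isLead_of_ne`); this is where the no broken condition
enters. Multiplying the expansion by the product of the `a i` over a cocircuit `Y` replaces `p b` by
`± D_Y p b`, while the other side keeps only the vectors outside `Y`, which do not span and so miss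
a leading coordinate. Hence `D_Y p b = 0`.

`T_X` itself is, up to a constant, the volume of the fibers of the map from the orthant to `V`. Its
equality with the piecewise polynomial function holds first almost everywhere, then on the regular
points, which form an open set because the cones of the no broken bases cover the cone of the
family, and finally on closures of big cells by continuity. -/

noncomputable section

open scoped Classical
open MvPolynomial

namespace Spline

/-! ### Polynomials as symbols of operators applied to a product of inverse linear forms. -/

section Symbols

variable {ι A A' : Type*} [Fintype ι] [CommRing A] [Algebra ℝ A] [CommRing A'] [Algebra ℝ A']
  {s : ℕ}

/-- With `β i = 1 / α i`, this is `∂^k (1 / ∏ α i)` in the coordinates `α`. -/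
def invMonomial (β : ι → A) (k : ι →₀ ℕ) : A :=
  ∏ i, (((-1 : A) ^ k i * ((k i).factorial : A)) * β i ^ (k i + 1))

/-- The linear map sending a polynomial `q` to `q(∂)(1 / ∏ α i)`, where `β i = 1 / α i`. -/
def symbolEval (β : ι → A) : MvPolynomial ι ℝ →ₗ[ℝ] A :=
  (basisMonomials ι ℝ).constr ℝ (invMonomial β)

/-- Substitution `x_j ↦ ∑ i, w_i(j) y_i`, expressing a polynomial on `V` in the coordinates
of the family `w`. -/
def pullback (w : ι → Fin s → ℝ) : MvPolynomial (Fin s) ℝ →ₐ[ℝ] MvPolynomial ι ℝ :=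
  aeval (fun j => ∑ i, C (w i j) * X i)

/-- The value of `p(∂)(1 / ∏ w i)` where `β i` is the value of `1 / w i`. -/
def fracEval (w : ι → Fin s → ℝ) (β : ι → A) : MvPolynomial (Fin s) ℝ →ₗ[ℝ] A :=
  symbolEval β ∘ₗ (pullback w).toLinearMap

lemma symbolEval_monomial (β : ι → A) (k : ι →₀ ℕ) (r : ℝ) :
    symbolEval β (monomial k r) = r • invMonomial β k := by
  have h : (monomial k r : MvPolynomial ι ℝ) = r • basisMonomials ι ℝ k := by
    simp [smul_monomial]
  rw [h, map_smul, symbolEval, Module.Basis.constr_basis]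

lemma symbolEval_eq_sum (β : ι → A) (q : MvPolynomial ι ℝ) :
    symbolEval β q = ∑ k ∈ q.support, q.coeff k • invMonomial β k := by
  conv_lhs => rw [q.as_sum, map_sum]
  exact Finset.sum_congr rfl fun k _ => symbolEval_monomial β k _

lemma map_invMonomial (φ : A →ₐ[ℝ] A') (β : ι → A) (k : ι →₀ ℕ) :
    φ (invMonomial β k) = invMonomial (fun i => φ (β i)) k := by
  simp [invMonomial]

lemma map_symbolEval (φ : A →ₐ[ℝ] A') (β : ι → A) (q : MvPolynomial ι ℝ) :
    φ (symbolEval β q) = symbolEval (fun i => φ (β i)) q := by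
  simp only [symbolEval_eq_sum, map_sum, map_smul, map_invMonomial]

/-- Naturality in the algebra allows one expression to be read at real points, with the inverses as
free variables, and in Laurent series. -/
lemma map_fracEval (φ : A →ₐ[ℝ] A') (w : ι → Fin s → ℝ) (β : ι → A)
    (p : MvPolynomial (Fin s) ℝ) :
    φ (fracEval w β p) = fracEval w (fun i => φ (β i)) p :=
  map_symbolEval φ β _

lemma fracEval_apply (w : ι → Fin s → ℝ) (β : ι → A) (p : MvPolynomial (Fin s) ℝ) :
    fracEval w β p = symbolEval β (pullback w p) := rfl

lemma eval_pullback (w : ι → Fin s → ℝ) (t : ι → ℝ) (p : MvPolynomial (Fin s) ℝ) :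
    eval t (pullback w p) = eval (∑ i, t i • w i) p := by
  induction p using MvPolynomial.induction_on with
  | C r => simp [pullback]
  | add p q hp hq => simp [hp, hq]
  | mul_X p j hp =>
    rw [map_mul, map_mul, map_mul, hp]
    simp [pullback, mul_comm]

lemma dirDeriv_mul (v : Fin s → ℝ) (p q : MvPolynomial (Fin s) ℝ) :
    dirDeriv v (p * q) = p * dirDeriv v q + q * dirDeriv v p := by
  simp [dirDeriv, Derivation.leibniz]

lemma dirDeriv_X (v : Fin s → ℝ) (j : Fin s) : dirDeriv v (X j) = C (v j) := by
  simp [dirDeriv]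

lemma dirDeriv_C (v : Fin s → ℝ) (r : ℝ) : dirDeriv v (C r) = 0 := by
  simp [dirDeriv]

lemma dirDeriv_eq_sum_pderiv (v : Fin s → ℝ) (p : MvPolynomial (Fin s) ℝ) :
    dirDeriv v p = ∑ j, v j • pderiv j p := by
  induction p using MvPolynomial.induction_on with
  | C r => simp [dirDeriv_C]
  | add p q hp hq => simp only [map_add, hp, hq, smul_add, Finset.sum_add_distrib]
  | mul_X p j hp =>
    rw [dirDeriv_mul, hp, dirDeriv_X]
    simp only [Derivation.leibniz, smul_add, Finset.sum_add_distrib, pderiv_X, smul_eq_mul,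
      Finset.mul_sum]
    congr 1
    · rw [Finset.sum_eq_single j]
      · simp [smul_eq_C_mul, mul_comm]
      · intro i _ hi
        simp [Ne.symm hi]
      · simp
    · simp

lemma coeff_dirDeriv (v : Fin s → ℝ) (p : MvPolynomial (Fin s) ℝ) (k : Fin s →₀ ℕ) :
    (dirDeriv v p).coeff k = ∑ j, v j * (p.coeff (k + Finsupp.single j 1) * (k j + 1)) := by
  rw [dirDeriv_eq_sum_pderiv, coeff_sum]
  exact Finset.sum_congr rfl fun j _ => by rw [coeff_smul, coeff_pderiv, smul_eq_mul]

lemma pullback_dirDeriv (w : Fin s → Fin s → ℝ) (c : Fin s → ℝ) (p : MvPolynomial (Fin s) ℝ) :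
    pullback w (dirDeriv (∑ i, c i • w i) p) = dirDeriv c (pullback w p) := by
  induction p using MvPolynomial.induction_on with
  | C r => simp [dirDeriv_C, pullback]
  | add p q hp hq => simp only [map_add, hp, hq]
  | mul_X p j hp =>
    rw [dirDeriv_mul, map_mul, map_add, map_mul, map_mul, hp, dirDeriv_mul]
    congr 2
    rw [dirDeriv_X]
    simp [pullback, dirDeriv_mul, dirDeriv_X, dirDeriv_C, mul_comm]

lemma pullback_injective (B : Module.Basis (Fin s) ℝ (Fin s → ℝ)) :
    Function.Injective (pullback (s := s) B) := by
  intro p q h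
  apply MvPolynomial.funext
  intro x
  rw [← B.sum_repr x, ← eval_pullback, ← eval_pullback, h]

lemma exists_pullback_eq_monomial (B : Module.Basis (Fin s) ℝ (Fin s → ℝ)) (k : Fin s →₀ ℕ)
    (r : ℝ) : ∃ p : MvPolynomial (Fin s) ℝ, p.IsHomogeneous (∑ i, k i) ∧
      pullback B p = monomial k r := by
  -- `φ` is the inverse substitution: the `i`-th variable goes to the `i`-th coordinate function of
  -- `B`.
  let φ : MvPolynomial (Fin s) ℝ →ₐ[ℝ] MvPolynomial (Fin s) ℝ :=
    aeval (fun i => ∑ j, C (B.repr (Pi.single j 1) i) * X j)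
  have hX : ∀ i, pullback B (φ (X i)) = X i := by
    intro i
    apply MvPolynomial.funext
    intro t
    rw [eval_pullback]
    have h1 : ∀ x : Fin s → ℝ, eval x (φ (X i)) = B.repr x i := by
      intro x
      conv_rhs => rw [← (Pi.basisFun ℝ (Fin s)).sum_repr x]
      simp [φ, mul_comm]
    rw [h1]
    simp [Finsupp.single_apply]
  refine ⟨φ (monomial k r), ?_, ?_⟩
  · have h : (monomial k r : MvPolynomial (Fin s) ℝ).IsHomogeneous (∑ i, k i) :=
      isHomogeneous_monomial r (by rw [Finsupp.degree_eq_sum])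
    have := h.aeval (n := 1) (fun i => ∑ j, C (B.repr (Pi.single j 1) i) * X j)
      (fun i => IsHomogeneous.sum _ _ _ fun j _ => isHomogeneous_C_mul_X _ _)
    simpa [φ] using this
  · have h : (pullback B).comp φ = AlgHom.id ℝ _ := by
      ext1 i
      simpa using hX i
    simpa using congrArg (fun f => f (monomial k r)) h

end Symbols

/-! ### The analytic operator `p(∂)` agrees with its symbol calculus. -/

section Differentiation

variable {ι : Type*} [Fintype ι] {s : ℕ}

/-- The linear form on `U` given by a vector of `V`. -/
def linForm (v : Fin s → ℝ) : (Fin s → ℝ) →L[ℝ] ℝ :=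
  LinearMap.toContinuousLinearMap (dotProductBilin ℝ ℝ v)

lemma linForm_apply (v u : Fin s → ℝ) : linForm v u = v ⬝ᵥ u := rfl

/-- Differentiating along the `i`-th linear form multiplies the symbol by `X i`; the chain rule sums
these contributions. -/
lemma hasFDerivAt_symbolEval (w : ι → Fin s → ℝ) {u : Fin s → ℝ} (hu : ∀ i, w i ⬝ᵥ u ≠ 0)
    (q : MvPolynomial ι ℝ) :
    HasFDerivAt (fun u => symbolEval (fun i => (w i ⬝ᵥ u)⁻¹) q)
      (∑ i, symbolEval (fun i => (w i ⬝ᵥ u)⁻¹) (X i * q) • linForm (w i)) u := by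
  induction q using MvPolynomial.induction_on' with
  | add p q hp hq =>
    simp only [map_add, mul_add, add_smul, Finset.sum_add_distrib]
    exact hp.add hq
  | monomial k r =>
    have h1 : ∀ i ∈ (Finset.univ : Finset ι), HasFDerivAt
        (fun u : Fin s → ℝ => ((-1 : ℝ) ^ k i * ((k i).factorial : ℝ)) * (w i ⬝ᵥ u)⁻¹ ^ (k i + 1))
        ((((-1 : ℝ) ^ (k i + 1) * ((k i + 1).factorial : ℝ)) * (w i ⬝ᵥ u)⁻¹ ^ (k i + 2)) •
          linForm (w i)) u := by
      intro i _
      have h2 : HasFDerivAt (fun u : Fin s → ℝ => w i ⬝ᵥ u) (linForm (w i)) u :=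
        (linForm (w i)).hasFDerivAt
      have h3 := ((((hasDerivAt_inv (hu i)).pow (k i + 1)).comp_hasFDerivAt u h2).const_mul
        ((-1 : ℝ) ^ k i * ((k i).factorial : ℝ)))
      refine h3.congr_fderiv ?_
      ext v
      simp only [smul_apply, smul_eq_mul]
      push_cast [Nat.factorial_succ]
      rw [← inv_pow]
      ring
    have h4 := (HasFDerivAt.finsetProd h1).const_mul r
    have h5 : (fun u => symbolEval (fun i => (w i ⬝ᵥ u)⁻¹) (monomial k r)) =
        fun u : Fin s → ℝ => r * ∏ i, (((-1 : ℝ) ^ k i * ((k i).factorial : ℝ)) *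
          (w i ⬝ᵥ u)⁻¹ ^ (k i + 1)) := by
      funext u
      rw [symbolEval_monomial]
      rfl
    rw [h5]
    refine h4.congr_fderiv ?_
    rw [Finset.smul_sum]
    refine Finset.sum_congr rfl fun i _ => ?_
    rw [smul_smul, smul_smul]
    congr 1
    rw [X, monomial_mul, one_mul, symbolEval_monomial, smul_eq_mul, invMonomial, mul_assoc]
    congr 1
    rw [← Finset.mul_prod_erase Finset.univ _ (Finset.mem_univ i), mul_comm]
    congr 1
    · simp only [Finsupp.coe_add, Pi.add_apply, Finsupp.single_eq_same, add_comm 1 (k i)]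
    · refine Finset.prod_congr rfl fun j hj => ?_
      have : j ≠ i := Finset.ne_of_mem_erase hj
      simp [this.symm]

lemma isOpen_ne_zero (w : ι → Fin s → ℝ) : IsOpen {u : Fin s → ℝ | ∀ i, w i ⬝ᵥ u ≠ 0} := by
  simp only [Set.ofPred_forall]
  exact isOpen_iInter_of_finite fun i => isOpen_ne_fun (linForm (w i)).continuous continuous_const

/-- Knowing `f` off the hyperplanes is enough, since that set is open; this makes the statement
iterable. -/
lemma partialD_symbolEval (w : ι → Fin s → ℝ) (j : Fin s) (q : MvPolynomial ι ℝ)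
    (f : (Fin s → ℝ) → ℝ)
    (hf : ∀ u, (∀ i, w i ⬝ᵥ u ≠ 0) → f u = symbolEval (fun i => (w i ⬝ᵥ u)⁻¹) q)
    (u : Fin s → ℝ) (hu : ∀ i, w i ⬝ᵥ u ≠ 0) :
    partialD j f u = symbolEval (fun i => (w i ⬝ᵥ u)⁻¹) (pullback w (X j) * q) := by
  have h1 : f =ᶠ[nhds u] fun u => symbolEval (fun i => (w i ⬝ᵥ u)⁻¹) q :=
    Filter.eventuallyEq_of_mem ((isOpen_ne_zero w).mem_nhds hu) fun v hv => hf v hv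
  rw [partialD, h1.fderiv_eq, (hasFDerivAt_symbolEval w hu q).fderiv]
  simp only [pullback, aeval_X, Finset.sum_mul, map_sum, sum_apply,
    smul_apply, linForm_apply, smul_eq_mul, mul_assoc]
  refine Finset.sum_congr rfl fun i _ => ?_
  rw [← smul_eq_C_mul, map_smul, smul_eq_mul, mul_comm]
  simp

lemma iterPartialD_symbolEval (w : ι → Fin s → ℝ) (m : Fin s →₀ ℕ)
    (u : Fin s → ℝ) (hu : ∀ i, w i ⬝ᵥ u ≠ 0) :
    iterPartialD m (fun u => (dProd w u)⁻¹) u =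
      symbolEval (fun i => (w i ⬝ᵥ u)⁻¹) (pullback w (monomial m 1)) := by
  have hit : ∀ (j : Fin s) (n : ℕ) (f : (Fin s → ℝ) → ℝ) (q : MvPolynomial (Fin s) ℝ),
      (∀ u, (∀ i, w i ⬝ᵥ u ≠ 0) → f u = symbolEval (fun i => (w i ⬝ᵥ u)⁻¹) (pullback w q)) →
      ∀ u, (∀ i, w i ⬝ᵥ u ≠ 0) → (partialD j)^[n] f u =
        symbolEval (fun i => (w i ⬝ᵥ u)⁻¹) (pullback w (X j ^ n * q)) := by
    intro j n
    induction n with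
    | zero => intro f q h; simpa using h
    | succ n ih =>
      intro f q h u hu
      rw [Function.iterate_succ_apply', partialD_symbolEval w j _ _ (ih f q h) u hu, ← map_mul]
      congr 2
      ring
  have hlist : ∀ l : List (Fin s), ∀ u, (∀ i, w i ⬝ᵥ u ≠ 0) →
      l.foldr (fun j g => (partialD j)^[m j] g) (fun u => (dProd w u)⁻¹) u =
        symbolEval (fun i => (w i ⬝ᵥ u)⁻¹) (pullback w (l.map fun j => X j ^ m j).prod) := by
    intro l
    induction l with
    | nil =>
      intro u hu
      have : (1 : MvPolynomial ι ℝ) = monomial 0 1 := rfl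
      simp only [List.foldr_nil, List.map_nil, List.prod_nil, map_one]
      rw [this, symbolEval_monomial]
      simp [invMonomial, dProd]
    | cons j l ih =>
      intro u hu
      rw [List.foldr_cons, List.map_cons, List.prod_cons]
      exact hit j (m j) _ _ ih u hu
  rw [iterPartialD, hlist _ u hu]
  congr 2
  rw [monomial_eq, Finsupp.prod_fintype _ _ (fun i => pow_zero _), ← Fin.prod_univ_def]
  simp

lemma polyDiff_eq_fracEval (w : ι → Fin s → ℝ) (p : MvPolynomial (Fin s) ℝ)
    (u : Fin s → ℝ) (hu : ∀ i, w i ⬝ᵥ u ≠ 0) :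
    polyDiff p (fun u => (dProd w u)⁻¹) u = fracEval w (fun i => (w i ⬝ᵥ u)⁻¹) p := by
  conv_rhs => rw [p.as_sum, map_sum]
  refine Finset.sum_congr rfl fun m _ => ?_
  rw [iterPartialD_symbolEval w m u hu, fracEval_apply, ← smul_eq_mul, ← map_smul, ← map_smul,
    smul_monomial, smul_eq_mul, mul_one]

end Differentiation

/-! ### Combinatorics of no broken bases. -/

section NoBroken

variable {s N : ℕ} {a : Fin N → Fin s → ℝ}

/-- The basis of `V` given by a no broken basis. -/
def NB.basis (b : NB a) : Module.Basis (Fin s) ℝ (Fin s → ℝ) :=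
  basisOfLinearIndependentOfCardEqFinrank' b.vec b.2.1 (by simp)

lemma NB.coe_basis (b : NB a) : ⇑b.basis = b.vec :=
  coe_basisOfLinearIndependentOfCardEqFinrank' _ _ _

lemma NB.ext_range {b c : NB a} (h : Set.range b.1 = Set.range c.1) : b = c :=
  Subtype.ext (OrderEmbedding.range_inj.1 h)

lemma NB.mem_range_of_le {b : NB a} {i : Fin N} {e : Fin s} (hi : i ≤ b.1 e)
    (h : a i ∈ Submodule.span ℝ (b.vec '' Set.Ici e)) : i ∈ Set.range b.1 := by
  rw [← b.2.2]
  exact ⟨e, hi, h⟩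

/-- The elements of `b` after `i` form a final segment, so `a i` breaks `b` there. If that segment
is empty, the span is zero, which `hi` excludes. -/
lemma NB.mem_range_of_mem_span (b : NB a) {i : Fin N} (hi : a i ≠ 0)
    (h : a i ∈ Submodule.span ℝ (a '' {j | j ∈ Set.range b.1 ∧ i < j})) :
    i ∈ Set.range b.1 := by
  by_cases hne : ∃ e, i < b.1 e
  · obtain ⟨e, he, hmin⟩ := WellFounded.has_min (wellFounded_lt (α := Fin s))
      {e | i < b.1 e} hne
    refine NB.mem_range_of_le (e := e) (le_of_lt he) (Submodule.span_mono ?_ h)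
    rintro _ ⟨_, ⟨⟨f, rfl⟩, hf⟩, rfl⟩
    exact ⟨f, not_lt.1 (hmin f hf), rfl⟩
  · exfalso
    have : {j | j ∈ Set.range b.1 ∧ i < j} = ∅ := by
      ext j
      simp only [Set.mem_ofPred_eq, Set.mem_empty_iff_false, iff_false]
      rintro ⟨⟨f, rfl⟩, hf⟩
      exact hne ⟨f, hf⟩
    rw [this, Set.image_empty, Submodule.span_empty] at h
    exact hi h

/-- A spanning sublist which is broken by none of the vectors outside it, in the sense that no
`a_i` depends on later elements of the sublist, is a no broken basis. -/
lemma exists_NB_of_unbroken (S : Finset (Fin N)) (hspan : Submodule.span ℝ (a '' S) = ⊤)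
    (hun : ∀ i, a i ∉ Submodule.span ℝ (a '' {j | j ∈ S ∧ i < j})) :
    ∃ b : NB a, Set.range b.1 = S := by
  -- In a nontrivial relation the vector of smallest index would depend on later elements of `S`.
  have hli : LinearIndepOn ℝ a (S : Set (Fin N)) := by
    rw [linearIndepOn_finset_iff]
    intro g hg
    by_contra! hne
    obtain ⟨i, ⟨hiS, hi⟩, hmin⟩ := WellFounded.has_min (wellFounded_lt (α := Fin N))
      {i | i ∈ S ∧ g i ≠ 0} hne
    apply hun i
    have h1 : a i = -((g i)⁻¹ • ∑ j ∈ S.erase i, g j • a j) := by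
      rw [← Finset.add_sum_erase S _ hiS] at hg
      rw [← smul_neg, ← eq_neg_of_add_eq_zero_left hg, smul_smul, inv_mul_cancel₀ hi, one_smul]
    rw [h1]
    refine Submodule.neg_mem _ (Submodule.smul_mem _ _ (Submodule.sum_mem _ fun j hj => ?_))
    by_cases hgj : g j = 0
    · simp [hgj]
    · refine Submodule.smul_mem _ _ (Submodule.subset_span ⟨j, ⟨Finset.mem_of_mem_erase hj, ?_⟩,
        rfl⟩)
      exact lt_of_le_of_ne (not_lt.1 (hmin j ⟨Finset.mem_of_mem_erase hj, hgj⟩))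
        (Finset.ne_of_mem_erase hj).symm
  have hcard : S.card = s := by
    have B : Module.Basis S ℝ (Fin s → ℝ) := Module.Basis.mk (v := fun i : S => a i) hli
      (by
        rw [← hspan]
        refine Submodule.span_mono ?_
        rintro _ ⟨i, hi, rfl⟩
        exact ⟨⟨i, hi⟩, rfl⟩)
    have := Module.finrank_eq_card_basis B
    simpa using this.symm
  have hrange : Set.range (S.orderEmbOfFin hcard) = S := Finset.range_orderEmbOfFin S hcard
  refine ⟨⟨S.orderEmbOfFin hcard, ?_, ?_⟩, hrange⟩
  · have := hli.comp (fun j : Fin s => (⟨S.orderEmbOfFin hcard j,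
      Finset.orderEmbOfFin_mem S hcard j⟩ : (S : Set (Fin N))))
      (fun i j h => (S.orderEmbOfFin hcard).injective (congrArg Subtype.val h))
    exact this
  · ext i
    constructor
    · rintro ⟨e, hie, h⟩
      rcases eq_or_lt_of_le hie with h1 | h1
      · exact ⟨e, h1.symm⟩
      · exfalso
        refine hun i (Submodule.span_mono ?_ h)
        rintro _ ⟨f, hf, rfl⟩
        exact ⟨_, ⟨Finset.orderEmbOfFin_mem S hcard f,
          h1.trans_le ((S.orderEmbOfFin hcard).monotone hf)⟩, rfl⟩
    · rintro ⟨e, rfl⟩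
      exact ⟨e, le_rfl, Submodule.subset_span ⟨e, Set.self_mem_Ici, rfl⟩⟩

end NoBroken

/-! ### Existence of the partial fraction expansion. -/

section PartialFractions

variable {s N : ℕ} {a : Fin N → Fin s → ℝ}

lemma exists_fracEval_eq_prod (b : NB a) (k : Fin s → ℕ) :
    ∃ p : MvPolynomial (Fin s) ℝ, p.IsHomogeneous (∑ i, k i) ∧
      ∀ β : Fin s → ℝ, fracEval b.vec β p = ∏ i, β i ^ (k i + 1) := by
  obtain ⟨p, hp, hpk⟩ := exists_pullback_eq_monomial b.basis (Finsupp.equivFunOnFinite.symm k)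
    (∏ i, ((-1 : ℝ) ^ k i * ((k i).factorial : ℝ)))⁻¹
  refine ⟨p, by simpa using hp, fun β => ?_⟩
  rw [fracEval_apply, ← NB.coe_basis, hpk, symbolEval_monomial, invMonomial,
    smul_eq_mul, ← Finset.prod_inv_distrib, ← Finset.prod_mul_distrib]
  refine Finset.prod_congr rfl fun i _ => ?_
  rw [Finsupp.equivFunOnFinite_symm_apply_apply, ← mul_assoc, inv_mul_cancel₀, one_mul]
  exact mul_ne_zero (pow_ne_zero _ (by norm_num)) (by positivity)

/-- The support of `m` is here a single no broken basis, which carries the whole expansion. Its `s`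
exponents are at least one, so the truncated subtraction in the degree is exact. -/
lemma exists_partialFraction_terminal (m : Fin N → ℕ)
    (hspan : Submodule.span ℝ (a '' {i | m i ≠ 0}) = ⊤)
    (hun : ∀ i, a i ∉ Submodule.span ℝ (a '' {j | m j ≠ 0 ∧ i < j})) :
    ∃ p : NB a → MvPolynomial (Fin s) ℝ, (∀ b, (p b).IsHomogeneous (∑ i, m i - s)) ∧
      ∀ β : Fin N → ℝ, ∏ i, β i ^ m i = ∑ b, fracEval b.vec (fun i => β (b.1 i)) (p b) := by
  obtain ⟨b, hb⟩ := exists_NB_of_unbroken (a := a) (Finset.univ.filter fun i => m i ≠ 0)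
    (by simpa using hspan) (by simpa using hun)
  have hmb : ∀ j, m (b.1 j) ≠ 0 := by
    intro j
    have : b.1 j ∈ ((Finset.univ.filter fun i => m i ≠ 0 : Finset (Fin N)) : Set (Fin N)) :=
      hb ▸ Set.mem_range_self j
    simpa using this
  have hm0 : ∀ i, i ∉ Set.range b.1 → m i = 0 := by
    intro i hi
    rw [hb] at hi
    simpa using hi
  obtain ⟨p, hp, hpe⟩ := exists_fracEval_eq_prod b (fun j => m (b.1 j) - 1)
  have hk : ∀ j, m (b.1 j) - 1 + 1 = m (b.1 j) := fun j => Nat.sub_add_cancel (by have := hmb j; omega)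
  refine ⟨Pi.single b p, fun c => ?_, fun β => ?_⟩
  · by_cases hc : c = b
    · subst hc
      rw [Pi.single_eq_same]
      convert hp using 1
      have h1 : ∑ i, m i = ∑ j, m (c.1 j) :=
        (Finset.sum_of_injOn c.1 c.1.injective.injOn (by simp) (fun i _ hi => hm0 i (by simpa using hi))
          (fun _ _ => rfl)).symm
      have h2 : ∑ j, m (c.1 j) = ∑ j, (m (c.1 j) - 1) + s := by
        rw [← Finset.sum_congr rfl fun j _ => hk j, Finset.sum_add_distrib]
        simp
      omega
    · rw [Pi.single_eq_of_ne hc]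
      exact isHomogeneous_zero _ _ _
  · rw [Finset.sum_eq_single b]
    · rw [Pi.single_eq_same, hpe]
      simp only [hk]
      exact (Finset.prod_of_injOn b.1 b.1.injective.injOn (by simp)
        (fun i _ hi => by rw [hm0 i (by simpa using hi), pow_zero]) (fun _ _ => rfl)).symm
    · intro c _ hc
      rw [Pi.single_eq_of_ne hc, map_zero]
    · simp

lemma exists_partialFraction (m : Fin N → ℕ)
    (hspan : Submodule.span ℝ (a '' {i | m i ≠ 0}) = ⊤) :
    ∃ p : NB a → MvPolynomial (Fin s) ℝ, (∀ b, (p b).IsHomogeneous (∑ i, m i - s)) ∧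
      ∀ u : Fin s → ℝ, (∀ i, a i ⬝ᵥ u ≠ 0) →
        ∏ i, (a i ⬝ᵥ u)⁻¹ ^ m i =
          ∑ b, fracEval b.vec (fun i => (b.vec i ⬝ᵥ u)⁻¹) (p b) := by
  -- This weight drops whenever a power moves from `a j` to an `a i` with `i < j`.
  induction hn : ∑ i : Fin N, i.val * m i using Nat.strong_induction_on generalizing m with
  | _ n ih =>
  by_cases hun : ∀ i, a i ∉ Submodule.span ℝ (a '' {j | m j ≠ 0 ∧ i < j})
  · obtain ⟨p, hp, hpe⟩ := exists_partialFraction_terminal m hspan hun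
    exact ⟨p, hp, fun u _ => hpe fun i => (a i ⬝ᵥ u)⁻¹⟩
  push Not at hun
  obtain ⟨i, hi⟩ := hun
  rw [Finsupp.mem_span_image_iff_linearCombination] at hi
  obtain ⟨c, hc, hci⟩ := hi
  have hcm : ∀ j ∈ c.support, m j ≠ 0 ∧ i < j := fun j hj => hc hj
  have hci' : a i = ∑ j ∈ c.support, c j • a j := hci.symm
  -- Multiply and divide by `a i`, then expand the numerator by the relation: the term of `a j`
  -- gains a power of `1/a i` and loses one of `1/a j`. The subtraction is not truncated, as `m j ≠
  -- 0` on the support of `c`.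
  let m' : Fin N → Fin N → ℕ := fun j => m + Pi.single i 1 - Pi.single j 1
  have hm' : ∀ j ∈ c.support, m' j + Pi.single j 1 = m + Pi.single i 1 := by
    intro j hj
    ext l
    have h1 := (hcm j hj).1
    have h2 := (hcm j hj).2
    by_cases hl : l = j
    · subst hl
      simp only [m', Pi.add_apply, Pi.sub_apply, Pi.single_eq_same, Pi.single_eq_of_ne h2.ne']
      omega
    · simp [m', Pi.single_eq_of_ne hl]
  have hsum : ∀ j ∈ c.support, ∑ l, m' j l = ∑ l, m l := by
    intro j hj
    have := congrArg (fun f => ∑ l, f l) (hm' j hj)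
    simpa [Finset.sum_add_distrib] using this
  have hweight : ∀ j ∈ c.support, ∑ l : Fin N, l.val * m' j l < n := by
    intro j hj
    have := congrArg (fun f => ∑ l : Fin N, l.val * f l) (hm' j hj)
    simp only [Pi.add_apply, mul_add, Finset.sum_add_distrib, Pi.single_apply, mul_ite, mul_one,
      mul_zero, Finset.sum_ite_eq', Finset.mem_univ, if_true, hn] at this
    have h2 : i.val < j.val := (hcm j hj).2
    omega
  have hsub : ∀ j ∈ c.support, ∀ l, l ≠ j → (m l ≠ 0 ∨ l = i) → m' j l ≠ 0 := by
    intro j hj l hl h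
    have := congrFun (hm' j hj) l
    simp only [Pi.add_apply, Pi.single_eq_of_ne hl, add_zero] at this
    rw [this]
    rcases h with h | rfl
    · omega
    · simp
  have hspan' : ∀ j ∈ c.support, Submodule.span ℝ (a '' {l | m' j l ≠ 0}) = ⊤ := by
    intro j hj
    rw [eq_top_iff, ← hspan, Submodule.span_le]
    have hmem : ∀ l, l ≠ j → (m l ≠ 0 ∨ l = i) → a l ∈ Submodule.span ℝ (a '' {l | m' j l ≠ 0}) :=
      fun l hl h => Submodule.subset_span ⟨l, hsub j hj l hl h, rfl⟩
    rintro _ ⟨l, hl, rfl⟩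
    by_cases hlj : l = j
    -- The vector `a l` may have left the denominator; solving the relation for it recovers it from
    -- `a i` and the other vectors of the relation.
    · subst hlj
      have hcl : c l ≠ 0 := Finsupp.mem_support_iff.1 hj
      have h1 : a l = (c l)⁻¹ • (a i - ∑ k ∈ c.support.erase l, c k • a k) := by
        rw [hci', ← Finset.add_sum_erase _ _ hj, add_sub_cancel_right, smul_smul,
          inv_mul_cancel₀ hcl, one_smul]
      rw [h1]
      refine Submodule.smul_mem _ _ (Submodule.sub_mem _ (hmem i (hcm l hj).2.ne (Or.inr rfl))
        (Submodule.sum_mem _ fun k hk => Submodule.smul_mem _ _ (hmem k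
          (Finset.ne_of_mem_erase hk) (Or.inl (hcm k (Finset.mem_of_mem_erase hk)).1))))
    · exact hmem l hlj (Or.inl hl)
  have hex : ∀ j : c.support, ∃ p : NB a → MvPolynomial (Fin s) ℝ,
      (∀ b, (p b).IsHomogeneous (∑ i, m i - s)) ∧
      ∀ u : Fin s → ℝ, (∀ i, a i ⬝ᵥ u ≠ 0) →
        ∏ i, (a i ⬝ᵥ u)⁻¹ ^ m' j i =
          ∑ b, fracEval b.vec (fun i => (b.vec i ⬝ᵥ u)⁻¹) (p b) := by
    intro j
    have := ih _ (hweight j j.2) (m' j) (hspan' j j.2) rfl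
    rwa [hsum j j.2] at this
  choose p hp hpe using hex
  refine ⟨fun b => ∑ j : c.support, c j • p j b, fun b => ?_, fun u hu => ?_⟩
  · exact IsHomogeneous.sum _ _ _ fun j _ => by
      rw [smul_eq_C_mul]
      simpa using (isHomogeneous_C _ _).mul (hp j b)
  · simp only [map_sum, map_smul]
    rw [Finset.sum_comm]
    simp only [← Finset.smul_sum, ← hpe _ u hu]
    rw [Finset.sum_coe_sort c.support (fun j => c j • ∏ i, (a i ⬝ᵥ u)⁻¹ ^ m' j i)]
    have h1 : ∏ l, (a l ⬝ᵥ u)⁻¹ ^ m l =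
        (a i ⬝ᵥ u) * ∏ l, (a l ⬝ᵥ u)⁻¹ ^ (m + Pi.single i 1 : Fin N → ℕ) l := by
      simp only [Pi.add_apply, pow_add, Finset.prod_mul_distrib, Pi.single_apply, pow_ite, pow_one,
        pow_zero, Finset.prod_ite_eq', Finset.mem_univ, if_true]
      rw [mul_comm, mul_assoc, inv_mul_cancel₀ (hu i), mul_one]
    have h2 : a i ⬝ᵥ u = ∑ j ∈ c.support, c j * (a j ⬝ᵥ u) := by
      rw [hci', sum_dotProduct]
      simp
    rw [h1, h2, Finset.sum_mul]
    refine Finset.sum_congr rfl fun j hj => ?_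
    rw [← hm' j hj]
    simp only [Pi.add_apply, pow_add, Finset.prod_mul_distrib, Pi.single_apply, pow_ite, pow_one,
      pow_zero, Finset.prod_ite_eq', Finset.mem_univ, if_true, smul_eq_mul]
    rw [mul_assoc]
    congr 1
    rw [mul_comm, mul_assoc, inv_mul_cancel₀ (hu j), mul_one]

lemma exists_isPartialFractionExpansion (hspan : Submodule.span ℝ (Set.range a) = ⊤) :
    ∃ p : NB a → MvPolynomial (Fin s) ℝ, (∀ b, (p b).IsHomogeneous (N - s)) ∧
      IsPartialFractionExpansion a p := by
  obtain ⟨p, hp, hpe⟩ := exists_partialFraction (a := a) (fun _ => 1) (by simpa using hspan)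
  refine ⟨p, by simpa using hp, fun u hu => ?_⟩
  rw [Finset.sum_congr rfl fun b _ => polyDiff_eq_fracEval b.vec (p b) u (fun i => hu _),
    ← hpe u hu]
  simp [dProd]

end PartialFractions

/-! ### Iterated Laurent series and their polar coefficients. -/

section LexField

variable {s : ℕ}

/-- Iterated Laurent series: the Hahn series field over `ℤ^s` with the lexicographic order. -/
abbrev LexField (s : ℕ) : Type := HahnSeries (Lex (Fin s → ℤ)) ℝ

/-- The exponent of the inverse of the `j`-th variable. -/
def lexExp (j : Fin s) : Lex (Fin s → ℤ) := toLex (Pi.single j 1)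

lemma ofLex_lexExp_apply (i j : Fin s) : ofLex (lexExp j) i = if i = j then 1 else 0 := by
  simp [lexExp, Pi.single_apply]

/-- The linear form with coordinates `c` in the variables of the field of iterated Laurent
series, the `j`-th variable having exponent `-lexExp j`. -/
def lexForm : (Fin s → ℝ) →ₗ[ℝ] LexField s where
  toFun c := ∑ j, HahnSeries.single (-lexExp j) (c j)
  map_add' c d := by simp [Finset.sum_add_distrib]
  map_smul' r c := by
    rw [RingHom.id_apply, Finset.smul_sum]
    refine Finset.sum_congr rfl fun j _ => ?_
    ext g
    rw [HahnSeries.coeff_smul]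
    by_cases hg : g = -lexExp j
    · simp [hg]
    · rw [HahnSeries.coeff_single_of_ne hg, HahnSeries.coeff_single_of_ne hg, smul_zero]

lemma lexForm_apply (c : Fin s → ℝ) :
    lexForm c = ∑ j, HahnSeries.single (-lexExp j) (c j) := rfl

lemma coeff_lexForm_mul (c : Fin s → ℝ) (f : LexField s) (g : Lex (Fin s → ℤ)) :
    (lexForm c * f).coeff g = ∑ j, c j * f.coeff (g + lexExp j) := by
  rw [lexForm_apply, Finset.sum_mul, HahnSeries.coeff_sum]
  exact Finset.sum_congr rfl fun j _ => by rw [HahnSeries.coeff_single_mul, sub_neg_eq_add]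

lemma lexForm_single (j : Fin s) :
    lexForm (Pi.single j 1) = HahnSeries.single (-lexExp j) (1 : ℝ) := by
  rw [lexForm_apply, Finset.sum_eq_single j]
  · simp
  · intro i _ hi
    simp [hi]
  · simp

lemma lexForm_single_inv (j : Fin s) :
    (lexForm (Pi.single j 1))⁻¹ = HahnSeries.single (lexExp j) (1 : ℝ) := by
  rw [lexForm_single, HahnSeries.inv_single, neg_neg, inv_one]

lemma coeff_lexForm (c : Fin s → ℝ) (j : Fin s) : (lexForm c).coeff (-lexExp j) = c j := by
  rw [lexForm_apply, HahnSeries.coeff_sum, Finset.sum_eq_single j]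
  · simp
  · intro i _ hi
    apply HahnSeries.coeff_single_of_ne
    intro h
    have := congrFun (congrArg ofLex (neg_injective h)) i
    rw [ofLex_lexExp_apply, ofLex_lexExp_apply] at this
    simp [hi] at this
  · simp

lemma lexForm_injective : Function.Injective (lexForm (s := s)) := by
  intro c d h
  funext j
  rw [← coeff_lexForm c, h, coeff_lexForm]

/-- The iterated Laurent series with no negative powers of the `j`-th variable. -/
def regularAt (j : Fin s) : Subalgebra ℝ (LexField s) where
  carrier := {f | ∀ g, f.coeff g ≠ 0 → ofLex g j ≤ 0}
  mul_mem' := by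
    intro f f' hf hf' g hg
    obtain ⟨g₁, h₁, g₂, h₂, rfl⟩ := HahnSeries.support_mul_subset hg
    exact add_nonpos (hf g₁ h₁) (hf' g₂ h₂)
  add_mem' := by
    intro f f' hf hf' g hg
    by_contra hcon
    apply hg
    rw [HahnSeries.coeff_add, not_not.1 (mt (hf g) hcon), not_not.1 (mt (hf' g) hcon), add_zero]
  algebraMap_mem' := by
    intro r g hg
    by_cases h : g = 0
    · rw [h]
      exact le_rfl
    · exact absurd (HahnSeries.coeff_single_of_ne h) hg

lemma lexForm_mem_regularAt (c : Fin s → ℝ) (j : Fin s) : lexForm c ∈ regularAt j := by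
  rw [lexForm_apply]
  refine Subalgebra.sum_mem _ fun i _ g hg => ?_
  by_cases h : g = -lexExp i
  · rw [h, ofLex_neg, Pi.neg_apply, ofLex_lexExp_apply]
    split_ifs <;> simp
  · exact absurd (HahnSeries.coeff_single_of_ne h) hg

lemma lexExp_lt {i l : Fin s} (h : l < i) : lexExp i < lexExp l := by
  refine ⟨l, fun j hj => ?_, ?_⟩
  · simp [lexExp, Pi.single_eq_of_ne hj.ne, Pi.single_eq_of_ne (hj.trans h).ne]
  · simp [lexExp, Pi.single_eq_of_ne h.ne]

/-- `l` is the first index with a nonzero coordinate. -/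
def IsLead (c : Fin s → ℝ) (l : Fin s) : Prop := c l ≠ 0 ∧ ∀ i < l, c i = 0

lemma exists_isLead {c : Fin s → ℝ} (hc : c ≠ 0) : ∃ l, IsLead c l := by
  obtain ⟨l, hl, hmin⟩ := WellFounded.has_min (wellFounded_lt (α := Fin s))
    {i | c i ≠ 0} (Function.ne_iff.1 hc)
  exact ⟨l, hl, fun i hi => not_not.1 fun h => hmin i h hi⟩

/-- The leading variable dominates, so the inverse is a geometric series with poles in that variable
only. The proof avoids the series by examining the least exponent of the inverse with a pole in the
`j`-th variable. -/
lemma inv_lexForm_mem_regularAt {c : Fin s → ℝ} {l j : Fin s} (hl : IsLead c l) (hj : j ≠ l) :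
    (lexForm c)⁻¹ ∈ regularAt j := by
  set y := (lexForm c)⁻¹ with hy
  have hne : lexForm c ≠ 0 := by
    intro h
    apply hl.1
    rw [← coeff_lexForm c, h, HahnSeries.coeff_zero]
  have hmul : lexForm c * y = 1 := mul_inv_cancel₀ hne
  by_contra hcon
  have hW : {g | g ∈ y.support ∧ 0 < ofLex g j}.Nonempty := by
    by_contra hemp
    apply hcon
    intro g hg
    by_contra hlt
    exact hemp ⟨g, hg, not_le.1 hlt⟩
  have hwf : {g | g ∈ y.support ∧ 0 < ofLex g j}.IsWF :=
    y.isWF_support.mono fun g hg => hg.1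
  obtain ⟨hg, hgj⟩ := hwf.min_mem hW
  have hmin : ∀ g', g' ∈ y.support → 0 < ofLex g' j → ¬ g' < hwf.min hW :=
    fun g' h1 h2 => hwf.not_lt_min hW ⟨h1, h2⟩
  generalize hwf.min hW = g at hg hgj hmin
  -- A contribution from `i > l` would come from an exponent smaller than `g` that still has a pole
  -- at `j`, against minimality.
  have h1 : (lexForm c * y).coeff (g - lexExp l) = c l * y.coeff g := by
    rw [coeff_lexForm_mul, Finset.sum_eq_single l]
    · rw [sub_add_cancel]
    · intro i _ hi
      rcases lt_or_gt_of_ne hi with h | h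
      · rw [hl.2 i h, zero_mul]
      · have : g - lexExp l + lexExp i ∉ y.support := by
          intro hmem
          refine hmin _ hmem ?_ ?_
          · rw [ofLex_add, ofLex_sub, Pi.add_apply, Pi.sub_apply, ofLex_lexExp_apply,
              ofLex_lexExp_apply, if_neg hj]
            split_ifs <;> linarith
          · rw [sub_add_eq_add_sub, sub_lt_iff_lt_add]
            exact add_lt_add_right (lexExp_lt h) g
        rw [HahnSeries.mem_support, not_not] at this
        rw [this, mul_zero]
    · simp
  have h2 : g - lexExp l ≠ 0 := by
    intro h
    have := congrFun (congrArg ofLex h) j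
    rw [ofLex_sub, Pi.sub_apply, ofLex_lexExp_apply, if_neg hj] at this
    rw [sub_zero] at this
    exact hgj.ne' this
  rw [hmul, HahnSeries.coeff_one, if_neg h2] at h1
  exact mul_ne_zero hl.1 hg h1.symm

/-- The normalized coefficients of the monomials with only negative powers of the variables. -/
def polarCoeff (f : LexField s) (k : Fin s →₀ ℕ) : ℝ :=
  (∏ i, ((-1 : ℝ) ^ k i * ((k i).factorial : ℝ)))⁻¹ * f.coeff (toLex fun i => (k i + 1 : ℤ))

lemma polarCoeff_sum {κ : Type*} (t : Finset κ) (f : κ → LexField s) (k : Fin s →₀ ℕ) :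
    polarCoeff (∑ b ∈ t, f b) k = ∑ b ∈ t, polarCoeff (f b) k := by
  simp only [polarCoeff, HahnSeries.coeff_sum, Finset.mul_sum]

lemma polarCoeff_of_mem_regularAt {f : LexField s} {j : Fin s} (hf : f ∈ regularAt j)
    (k : Fin s →₀ ℕ) : polarCoeff f k = 0 := by
  rw [polarCoeff, mul_eq_zero]
  right
  by_contra h
  have := hf _ h
  simp only [ofLex_toLex] at this
  omega

lemma invMonomial_lexForm (k : Fin s →₀ ℕ) :
    invMonomial (fun i => (lexForm (Pi.single i 1) : LexField s)⁻¹) k =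
      HahnSeries.single (toLex fun i => (k i + 1 : ℤ))
        (∏ i, ((-1 : ℝ) ^ k i * ((k i).factorial : ℝ))) := by
  have h1 : ∀ (t : Finset (Fin s)) (r : Fin s → ℝ) (g : Fin s → Lex (Fin s → ℤ)),
      ∏ i ∈ t, HahnSeries.single (g i) (r i) = HahnSeries.single (∑ i ∈ t, g i) (∏ i ∈ t, r i) := by
    intro t r g
    induction t using Finset.induction_on with
    | empty => simp
    | insert i t hi ih =>
      rw [Finset.prod_insert hi, ih, HahnSeries.single_mul_single, Finset.sum_insert hi,
        Finset.prod_insert hi]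
  have h2 : ∀ i, ((-1 : LexField s) ^ k i * ((k i).factorial : LexField s)) *
      ((lexForm (Pi.single i 1) : LexField s)⁻¹) ^ (k i + 1) =
      HahnSeries.single ((k i + 1) • lexExp i) ((-1 : ℝ) ^ k i * ((k i).factorial : ℝ)) := by
    intro i
    rw [lexForm_single_inv, HahnSeries.single_pow, one_pow]
    have : ((-1 : LexField s) ^ k i * ((k i).factorial : LexField s)) =
        HahnSeries.C ((-1 : ℝ) ^ k i * ((k i).factorial : ℝ)) := by
      rw [map_mul, map_pow, map_neg, map_one, map_natCast]
    rw [this, HahnSeries.C_apply, HahnSeries.single_mul_single, zero_add, mul_one]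
  rw [invMonomial, Finset.prod_congr rfl fun i _ => h2 i, h1]
  congr 2
  apply ofLex.injective
  funext j
  rw [ofLex_toLex]
  have h3 : ∀ t : Finset (Fin s), ofLex (∑ i ∈ t, (k i + 1) • lexExp i) j =
      ∑ i ∈ t, (k i + 1) • ofLex (lexExp i) j := by
    intro t
    induction t using Finset.induction_on with
    | empty => rfl
    | insert i t hi ih =>
      rw [Finset.sum_insert hi, Finset.sum_insert hi, ofLex_add, Pi.add_apply, ih]
      rfl
  rw [h3]
  simp only [ofLex_lexExp_apply, nsmul_eq_mul, mul_ite, mul_one, mul_zero, Finset.sum_ite_eq,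
    Finset.mem_univ, if_true]
  push_cast
  rfl

/-- The normalization of `polarCoeff` is chosen to cancel the sign and factorials of `invMonomial`,
so the symbol is read off directly. -/
lemma polarCoeff_symbolEval (q : MvPolynomial (Fin s) ℝ) (k : Fin s →₀ ℕ) :
    polarCoeff (symbolEval (fun i => (lexForm (Pi.single i 1) : LexField s)⁻¹) q) k =
      q.coeff k := by
  rw [symbolEval_eq_sum, polarCoeff_sum]
  simp only [polarCoeff, HahnSeries.coeff_smul, invMonomial_lexForm]
  rw [Finset.sum_eq_single k]
  · rw [HahnSeries.coeff_single_same, smul_eq_mul, mul_comm, mul_assoc, mul_inv_cancel₀, mul_one]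
    exact Finset.prod_ne_zero_iff.2 fun i _ =>
      mul_ne_zero (pow_ne_zero _ (by norm_num)) (by positivity)
  · intro m _ hm
    rw [HahnSeries.coeff_single_of_ne, smul_zero, mul_zero]
    intro h
    apply hm
    ext i
    have := congrFun (toLex.injective h) i
    omega
  · intro hk
    rw [notMem_support_iff.1 hk, zero_smul, mul_zero]

/-- A variable lowers its own pole order by one, so polar coefficients of the product come from
polar coefficients of `f` alone. By `coeff_dirDeriv`, the effect on symbols is minus the directional
derivative. -/
lemma polarCoeff_lexForm_mul (c : Fin s → ℝ) (f : LexField s) (k : Fin s →₀ ℕ) :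
    polarCoeff (lexForm c * f) k =
      -∑ j, c j * (polarCoeff f (k + Finsupp.single j 1) * (k j + 1)) := by
  rw [polarCoeff, coeff_lexForm_mul, Finset.mul_sum, ← Finset.sum_neg_distrib]
  refine Finset.sum_congr rfl fun j _ => ?_
  rw [polarCoeff]
  have h1 : (toLex fun i => (((k + Finsupp.single j 1 : Fin s →₀ ℕ) i : ℕ) + 1 : ℤ)) =
      (toLex fun i => (k i + 1 : ℤ)) + lexExp j := by
    apply ofLex.injective
    funext i
    rw [ofLex_add, Pi.add_apply, ofLex_lexExp_apply]
    simp only [ofLex_toLex, Finsupp.coe_add, Pi.add_apply, Finsupp.single_apply, eq_comm (a := j)]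
    push_cast
    ring
  have h2 : (∏ i, ((-1 : ℝ) ^ (k + Finsupp.single j 1 : Fin s →₀ ℕ) i *
      (((k + Finsupp.single j 1 : Fin s →₀ ℕ) i).factorial : ℝ))) =
      -((k j + 1) * ∏ i, ((-1 : ℝ) ^ k i * ((k i).factorial : ℝ))) := by
    rw [← Finset.mul_prod_erase Finset.univ _ (Finset.mem_univ j),
      ← Finset.mul_prod_erase Finset.univ (fun i => (-1 : ℝ) ^ k i * ((k i).factorial : ℝ))
        (Finset.mem_univ j)]
    have h3 : ∀ i ∈ Finset.univ.erase j, ((-1 : ℝ) ^ (k + Finsupp.single j 1 : Fin s →₀ ℕ) i *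
      (((k + Finsupp.single j 1 : Fin s →₀ ℕ) i).factorial : ℝ)) = (-1 : ℝ) ^ k i * ((k i).factorial : ℝ) := by
      intro i hi
      have : i ≠ j := Finset.ne_of_mem_erase hi
      simp [this.symm]
    rw [Finset.prod_congr rfl h3]
    simp only [Finsupp.coe_add, Pi.add_apply, Finsupp.single_eq_same, Nat.factorial_succ]
    push_cast
    ring
  rw [h1, h2, inv_neg, mul_inv]
  have h4 : (k j + 1 : ℝ) ≠ 0 := by positivity
  field_simp

end LexField

/-! ### Transfer of rational identities from an open set to arbitrary fields. -/

section Transfer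

variable {s N : ℕ}

lemma eq_zero_of_eval_eq_zero_on_isOpen {O : Set (Fin s → ℝ)} (hO : IsOpen O) (hne : O.Nonempty)
    (r : MvPolynomial (Fin s) ℝ) (h : ∀ u ∈ O, eval u r = 0) : r = 0 := by
  obtain ⟨x, hx⟩ := hne
  obtain ⟨ε, hε, hb⟩ := Metric.isOpen_iff.1 hO x hx
  refine funext_set (fun i => Metric.ball (x i) ε) (fun i => ?_) fun y hy => ?_
  · rw [Real.ball_eq_Ioo]
    exact Set.Ioo_infinite (by linarith)
  · rw [map_zero]
    refine h y (hb ?_)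
    rw [ball_pi x hε]
    exact hy

/-- Identities between rational functions with linear denominators which hold on a nonempty open
set hold in any field. -/
lemma aeval_inv_eq_zero_of_isOpen (a : Fin N → Fin s → ℝ) {O : Set (Fin s → ℝ)} (hO : IsOpen O)
    (hne : O.Nonempty) (hOa : ∀ u ∈ O, ∀ i, a i ⬝ᵥ u ≠ 0) (P : MvPolynomial (Fin N) ℝ)
    (hP : ∀ u ∈ O, eval (fun i => (a i ⬝ᵥ u)⁻¹) P = 0)
    {K : Type} [Field K] [Algebra ℝ K] (x : Fin s → K) (hx : ∀ i, ∑ j, a i j • x j ≠ 0) :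
    aeval (fun i => (∑ j, a i j • x j)⁻¹) P = 0 := by
  let ℓ : Fin N → MvPolynomial (Fin s) ℝ := fun i => ∑ j, C (a i j) * X j
  let d : MvPolynomial (Fin s) ℝ := ∏ i, ℓ i
  let S := Localization (Submonoid.powers d)
  have hunit : ∀ i, IsUnit (algebraMap (MvPolynomial (Fin s) ℝ) S (ℓ i)) := fun i =>
    isUnit_of_dvd_unit (map_dvd _ (Finset.dvd_prod_of_mem ℓ (Finset.mem_univ i)))
      (IsLocalization.map_units S ⟨d, Submonoid.mem_powers d⟩)
  choose y hy using fun i => (hunit i).exists_right_inv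
  -- Clearing denominators once in the localization gives `P(1/ℓ) * d ^ n = r`, valid in every field
  -- where the `ℓ i` are nonzero. The real points of `O` force `r = 0`.
  obtain ⟨⟨r, ⟨_, n, rfl⟩⟩, hr⟩ := IsLocalization.surj (Submonoid.powers d) (aeval y P : S)
  have key : ∀ {F : Type} [Field F] [Algebra ℝ F] (f : MvPolynomial (Fin s) ℝ →ₐ[ℝ] F),
      (∀ i, f (ℓ i) ≠ 0) → aeval (fun i => (f (ℓ i))⁻¹) P * f d ^ n = f r := by
    intro F _ _ f hf
    have hd : f d ≠ 0 := by
      rw [map_prod]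
      exact Finset.prod_ne_zero_iff.2 fun i _ => hf i
    let g : S →ₐ[ℝ] F := IsLocalization.liftAlgHom (M := Submonoid.powers d) (f := f) (by
      rintro ⟨_, m, rfl⟩
      exact (isUnit_iff_ne_zero.2 (by simpa using fun h => absurd h hd)))
    have hg : ∀ q, g (algebraMap _ S q) = f q := fun q =>
      IsLocalization.lift_eq _ q
    have hgy : ∀ i, g (y i) = (f (ℓ i))⁻¹ := by
      intro i
      have := congrArg g (hy i)
      rw [map_mul, hg, map_one] at this
      exact eq_inv_of_mul_eq_one_right this
    have := congrArg g hr
    rw [map_mul, hg, hg, map_pow] at this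
    rw [← this]
    congr 1
    rw [← AlgHom.comp_apply, comp_aeval]
    simp only [hgy]
  have hr0 : r = 0 := by
    refine eq_zero_of_eval_eq_zero_on_isOpen hO hne r fun u hu => ?_
    have hℓ : ∀ i, (aeval u : MvPolynomial (Fin s) ℝ →ₐ[ℝ] ℝ) (ℓ i) = a i ⬝ᵥ u := by
      intro i
      simp [ℓ, dotProduct]
    have h1 := key (aeval u) (fun i => by rw [hℓ]; exact hOa u hu i)
    simp only [hℓ] at h1
    have h2 : aeval (fun i => (a i ⬝ᵥ u)⁻¹) P = (0 : ℝ) := by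
      rw [← hP u hu]
      rfl
    rw [h2, zero_mul] at h1
    rw [h1]
    rfl
  have hℓ : ∀ i, (aeval x : MvPolynomial (Fin s) ℝ →ₐ[ℝ] K) (ℓ i) = ∑ j, a i j • x j := by
    intro i
    simp [ℓ, Algebra.smul_def]
  have h1 := key (aeval x) (fun i => by rw [hℓ]; exact hx i)
  simp only [hℓ, hr0, map_zero] at h1
  refine (mul_eq_zero.1 h1).resolve_right (pow_ne_zero _ ?_)
  rw [map_prod]
  exact Finset.prod_ne_zero_iff.2 fun i _ => by rw [hℓ]; exact hx i

end Transfer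

/-! ### Leading coordinates with respect to a no broken basis. -/

section Leads

variable {s N : ℕ} {a : Fin N → Fin s → ℝ}

/-- The system is triangular with nonzero diagonal and is solved from the last index downwards. -/
lemma mem_span_of_isLead (B : Module.Basis (Fin s) ℝ (Fin s → ℝ)) (v : Fin s → Fin s → ℝ)
    (hv : ∀ l, IsLead (B.equivFun (v l)) l) (l : Fin s) :
    B l ∈ Submodule.span ℝ (v '' Set.Ici l) := by
  induction l using WellFoundedGT.induction with
  | _ l ih =>
  have h1 := B.sum_equivFun (v l)
  rw [← Finset.add_sum_erase _ _ (Finset.mem_univ l)] at h1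
  have h2 : B l = (B.equivFun (v l) l)⁻¹ •
      (v l - ∑ m ∈ Finset.univ.erase l, B.equivFun (v l) m • B m) := by
    nth_rewrite 2 [← h1]
    rw [add_sub_cancel_right, smul_smul, inv_mul_cancel₀ (hv l).1, one_smul]
  rw [h2]
  refine Submodule.smul_mem _ _ (Submodule.sub_mem _
    (Submodule.subset_span ⟨l, Set.self_mem_Ici, rfl⟩) (Submodule.sum_mem _ fun m hm => ?_))
  rcases lt_or_gt_of_ne (Finset.ne_of_mem_erase hm) with h | h
  · rw [(hv l).2 m h, zero_smul]
    exact Submodule.zero_mem _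
  · exact Submodule.smul_mem _ _ (Submodule.span_mono
      (Set.image_mono (Set.Ici_subset_Ici.2 h.le)) (ih m h))

/-- Suppose each coordinate `j` leads some vector `σ j` of `c`, and let `b_j` lie outside `c`. The
vectors `σ l` with `l ≥ j` lie in the span of the `b_m` with `m ≥ j`. One of smaller index than
`b_j` would break `b`, hence be some `b_m` with `m < j`, contradicting its lead. So all come later
than `b_j`, whose dependence on them, by triangularity, puts it in `c`. Thus `b ⊆ c`, and both have
`s` elements. -/
lemma exists_forall_not_isLead_of_ne (ha : ∀ i, a i ≠ 0) {b c : NB a} (hbc : b ≠ c) :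
    ∃ j, ∀ i, ¬ IsLead (b.basis.equivFun (c.vec i)) j := by
  by_contra! hcon
  choose σ hσ using hcon
  have hsub : Set.range b.1 ⊆ Set.range c.1 := by
    rintro _ ⟨j, rfl⟩
    by_contra hj
    apply hj
    have hmem := mem_span_of_isLead b.basis (fun l => c.vec (σ l)) hσ j
    rw [NB.coe_basis] at hmem
    refine NB.mem_range_of_mem_span c (ha _) (Submodule.span_mono ?_ hmem)
    rintro _ ⟨l, hl, rfl⟩
    refine ⟨c.1 (σ l), ⟨⟨σ l, rfl⟩, ?_⟩, rfl⟩
    have hne : b.1 j ≠ c.1 (σ l) := fun h => hj (h ▸ ⟨σ l, rfl⟩)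
    refine lt_of_le_of_ne (not_lt.1 fun hlt => ?_) hne
    have hspan : a (c.1 (σ l)) ∈ Submodule.span ℝ (b.vec '' Set.Ici j) := by
      have h1 := b.basis.sum_equivFun (c.vec (σ l))
      change c.vec (σ l) ∈ _
      rw [← h1]
      refine Submodule.sum_mem _ fun m _ => ?_
      rcases lt_or_ge m j with h | h
      · rw [(hσ l).2 m (h.trans_le hl), zero_smul]
        exact Submodule.zero_mem _
      · exact Submodule.smul_mem _ _ (Submodule.subset_span ⟨m, h, by rw [NB.coe_basis]⟩)
    obtain ⟨m, hm⟩ := NB.mem_range_of_le hlt.le hspan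
    have hmj : m < j := b.1.lt_iff_lt.1 (hm ▸ hlt)
    have h2 : c.vec (σ l) = b.basis m := by
      rw [NB.coe_basis]
      exact congrArg a hm.symm
    have h3 := (hσ l).2 m (hmj.trans_le hl)
    rw [h2] at h3
    simp at h3
  apply hbc
  apply NB.ext_range
  refine Set.eq_of_subset_of_ncard_le hsub ?_ (Set.toFinite _)
  rw [Set.ncard_range_of_injective b.1.injective, Set.ncard_range_of_injective c.1.injective]

lemma exists_forall_not_isLead_of_span_ne_top (b : NB a) {T : Set (Fin N)}
    (hT : Submodule.span ℝ (a '' T) ≠ ⊤) :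
    ∃ j, ∀ i ∈ T, ¬ IsLead (b.basis.equivFun (a i)) j := by
  by_contra! hcon
  choose σ hσT hσ using hcon
  apply hT
  rw [eq_top_iff, ← b.basis.span_eq, Submodule.span_le]
  rintro _ ⟨l, rfl⟩
  refine Submodule.span_mono ?_ (mem_span_of_isLead b.basis (fun l => a (σ l)) hσ l)
  rintro _ ⟨m, -, rfl⟩
  exact ⟨σ m, hσT m, rfl⟩

/-- A vector of `V` as a linear form in the iterated Laurent series attached to a no broken
basis. -/
def NB.form (b : NB a) : (Fin s → ℝ) →ₗ[ℝ] LexField s :=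
  lexForm ∘ₗ b.basis.equivFun.toLinearMap

lemma NB.form_apply (b : NB a) (v : Fin s → ℝ) : b.form v = lexForm (b.basis.equivFun v) := rfl

lemma NB.form_eq_sum (b : NB a) (v : Fin s → ℝ) :
    b.form v = ∑ j, v j • b.form (Pi.single j 1) := by
  conv_lhs => rw [← (Pi.basisFun ℝ (Fin s)).sum_repr v]
  simp

lemma NB.form_ne_zero (b : NB a) {v : Fin s → ℝ} (hv : v ≠ 0) : b.form v ≠ 0 := by
  rw [NB.form_apply, Ne, ← map_zero (lexForm (s := s)), lexForm_injective.eq_iff]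
  simpa using hv

lemma NB.form_vec (b : NB a) (i : Fin s) : b.form (b.vec i) = lexForm (Pi.single i 1) := by
  rw [NB.form_apply, ← NB.coe_basis]
  congr 1
  funext j
  rw [b.basis.equivFun_self]
  simp [Pi.single_apply, eq_comm]

lemma NB.inv_form_mem_regularAt (b : NB a) {v : Fin s → ℝ} (hv : v ≠ 0) {j : Fin s}
    (hj : ¬ IsLead (b.basis.equivFun v) j) : (b.form v)⁻¹ ∈ regularAt j := by
  obtain ⟨l, hl⟩ := exists_isLead (c := b.basis.equivFun v) (by simpa using hv)
  exact inv_lexForm_mem_regularAt hl fun h => hj (h ▸ hl)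

lemma fracEval_mem {A ι : Type*} [CommRing A] [Algebra ℝ A] [Fintype ι] (S : Subalgebra ℝ A)
    (w : ι → Fin s → ℝ) {β : ι → A} (hβ : ∀ i, β i ∈ S) (p : MvPolynomial (Fin s) ℝ) :
    fracEval w β p ∈ S := by
  have := map_fracEval S.val w (fun i => (⟨β i, hβ i⟩ : S)) p
  simp only [Subalgebra.coe_val] at this
  rw [← this]
  exact SetLike.coe_mem _

lemma polarCoeff_fracEval_self (b : NB a) (p : MvPolynomial (Fin s) ℝ) (k : Fin s →₀ ℕ) :
    polarCoeff (fracEval b.vec (fun i => (b.form (b.vec i))⁻¹) p) k =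
      (pullback b.vec p).coeff k := by
  simp only [NB.form_vec]
  rw [fracEval_apply, polarCoeff_symbolEval]

lemma exists_fracEval_mem_regularAt (ha : ∀ i, a i ≠ 0) {b c : NB a} (hbc : b ≠ c)
    (p : MvPolynomial (Fin s) ℝ) :
    ∃ j, fracEval c.vec (fun i => (b.form (c.vec i))⁻¹) p ∈ regularAt j := by
  obtain ⟨j, hj⟩ := exists_forall_not_isLead_of_ne ha hbc
  exact ⟨j, fracEval_mem _ _ (fun i => b.inv_form_mem_regularAt (ha _) (hj i)) p⟩

/-- Only the polar coefficients of `f` are constrained: its remaining terms never contribute. -/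
lemma polarCoeff_list_prod_mul (b : NB a) (l : List (Fin N)) (f : LexField s)
    (p : MvPolynomial (Fin s) ℝ) (hf : ∀ k, polarCoeff f k = (pullback b.vec p).coeff k)
    (k : Fin s →₀ ℕ) :
    polarCoeff ((l.map fun i => b.form (a i)).prod * f) k =
      (-1) ^ l.length * (pullback b.vec ((l.map fun i => dirDeriv (a i)).prod p)).coeff k := by
  induction l generalizing k with
  | nil => simpa using hf k
  | cons i l ih =>
    have h1 : a i = ∑ j, b.basis.equivFun (a i) j • b.vec j := by
      rw [← NB.coe_basis]
      exact (b.basis.sum_equivFun (a i)).symm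
    simp only [List.map_cons, List.prod_cons, mul_assoc, List.length_cons]
    rw [NB.form_apply, polarCoeff_lexForm_mul, Module.End.mul_apply]
    conv_rhs => rw [h1]
    rw [pullback_dirDeriv, coeff_dirDeriv, pow_succ, mul_assoc, neg_one_mul, mul_neg]
    congr 1
    rw [Finset.mul_sum]
    refine Finset.sum_congr rfl fun j _ => ?_
    rw [ih]
    ring

end Leads

/-! ### Independence of the fractions, and membership in `D(X)`. -/

section Uniqueness

variable {s N : ℕ} {a : Fin N → Fin s → ℝ}

lemma aeval_form_eq_zero (ha : ∀ i, a i ≠ 0) (b : NB a) {O : Set (Fin s → ℝ)} (hO : IsOpen O)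
    (hne : O.Nonempty) (hOa : ∀ u ∈ O, ∀ i, a i ⬝ᵥ u ≠ 0) (P : MvPolynomial (Fin N) ℝ)
    (hP : ∀ u ∈ O, eval (fun i => (a i ⬝ᵥ u)⁻¹) P = 0) :
    aeval (fun i => (b.form (a i))⁻¹) P = (0 : LexField s) := by
  have := aeval_inv_eq_zero_of_isOpen a hO hne hOa P hP (fun j => b.form (Pi.single j 1))
    (fun i => by rw [← NB.form_eq_sum]; exact b.form_ne_zero (ha i))
  simpa only [← NB.form_eq_sum] using this

/-- This presents the fractions as polynomials in the inverses `1/a i`, the form required by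
`aeval_inv_eq_zero_of_isOpen`. -/
lemma eval_fracEval_X (c : NB a) (u : Fin s → ℝ) (p : MvPolynomial (Fin s) ℝ) :
    eval (fun i => (a i ⬝ᵥ u)⁻¹)
      (fracEval c.vec (fun i => (X (c.1 i) : MvPolynomial (Fin N) ℝ)) p) =
      fracEval c.vec (fun i => (c.vec i ⬝ᵥ u)⁻¹) p := by
  have := map_fracEval (aeval (fun i => (a i ⬝ᵥ u)⁻¹) : MvPolynomial (Fin N) ℝ →ₐ[ℝ] ℝ) c.vec
    (fun i => X (c.1 i)) p
  simp only [aeval_X] at this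
  exact this

/-- The functions `p(∂)(1/d_b)`, with `b` a no broken basis, are independent. -/
lemma eq_zero_of_sum_fracEval_eq_zero (ha : ∀ i, a i ≠ 0) {O : Set (Fin s → ℝ)} (hO : IsOpen O)
    (hne : O.Nonempty) (hOa : ∀ u ∈ O, ∀ i, a i ⬝ᵥ u ≠ 0) (r : NB a → MvPolynomial (Fin s) ℝ)
    (hr : ∀ u ∈ O, ∑ b, fracEval b.vec (fun i => (b.vec i ⬝ᵥ u)⁻¹) (r b) = 0) : r = 0 := by
  funext b
  have h1 := aeval_form_eq_zero ha b hO hne hOa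
    (∑ c : NB a, fracEval c.vec (fun i => X (c.1 i)) (r c)) (fun u hu => by
      rw [← hr u hu, map_sum]
      refine Finset.sum_congr rfl fun c _ => ?_
      exact eval_fracEval_X c u (r c))
  simp only [map_sum, map_fracEval, aeval_X] at h1
  apply pullback_injective b.basis
  rw [Pi.zero_apply, map_zero, NB.coe_basis]
  ext k
  have h2 := congrArg (fun f => polarCoeff f k) h1
  simp only [polarCoeff_sum] at h2
  -- Any other summand has no pole in some coordinate of `b`, hence no polar coefficients.
  rw [Finset.sum_eq_single b] at h2
  · rw [coeff_zero, ← polarCoeff_fracEval_self]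
    refine h2.trans ?_
    simp [polarCoeff]
  · intro c _ hc
    obtain ⟨j, hj⟩ := exists_fracEval_mem_regularAt ha (Ne.symm hc) (r c)
    exact polarCoeff_of_mem_regularAt hj k
  · simp

lemma nonempty_dotProduct_ne_zero (ha : ∀ i, a i ≠ 0) :
    {u : Fin s → ℝ | ∀ i, a i ⬝ᵥ u ≠ 0}.Nonempty := by
  by_contra hcon
  have h1 : (∏ i, ∑ j, C (a i j) * X j : MvPolynomial (Fin s) ℝ) = 0 := by
    apply MvPolynomial.funext
    intro u
    by_contra h
    apply hcon
    refine ⟨u, fun i hi => h ?_⟩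
    rw [map_prod, map_zero]
    refine Finset.prod_eq_zero (Finset.mem_univ i) ?_
    simpa [dotProduct] using hi
  obtain ⟨i, -, hi⟩ := Finset.prod_eq_zero_iff.1 h1
  apply ha i
  funext j
  have := congrArg (eval (Pi.single j 1)) hi
  simpa [Pi.single_apply] using this

lemma IsPartialFractionExpansion.sum_fracEval {p : NB a → MvPolynomial (Fin s) ℝ}
    (hp : IsPartialFractionExpansion a p) (u : Fin s → ℝ) (hu : ∀ i, a i ⬝ᵥ u ≠ 0) :
    (dProd a u)⁻¹ = ∑ b, fracEval b.vec (fun i => (b.vec i ⬝ᵥ u)⁻¹) (p b) := by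
  rw [hp u hu]
  exact Finset.sum_congr rfl fun b _ => polyDiff_eq_fracEval b.vec (p b) u fun i => hu _

lemma IsPartialFractionExpansion.unique (ha : ∀ i, a i ≠ 0) {p q : NB a → MvPolynomial (Fin s) ℝ}
    (hp : IsPartialFractionExpansion a p) (hq : IsPartialFractionExpansion a q) : q = p := by
  rw [← sub_eq_zero]
  refine eq_zero_of_sum_fracEval_eq_zero ha (isOpen_ne_zero a)
    (nonempty_dotProduct_ne_zero ha) (fun u hu => hu) _ fun u hu => ?_
  simp only [Pi.sub_apply, map_sub, Finset.sum_sub_distrib]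
  rw [← hp.sum_fracEval u hu, ← hq.sum_fracEval u hu, sub_self]

/-- Multiply the expansion by the forms of `Y` and compare polar coefficients at `b`. The left side
becomes the inverse product over the complement of `Y`, regular in some coordinate. On the right the
terms `c ≠ b` stay regular in some coordinate, and the term of `b` gives `± D_Y (p b)`. -/
lemma IsPartialFractionExpansion.mem_spaceD (ha : ∀ i, a i ≠ 0)
    {p : NB a → MvPolynomial (Fin s) ℝ} (hp : IsPartialFractionExpansion a p) (b : NB a) :
    p b ∈ spaceD a := by
  simp only [spaceD, Submodule.mem_iInf, LinearMap.mem_ker]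
  intro Y hY
  have h1 := aeval_form_eq_zero ha b (isOpen_ne_zero a)
    (nonempty_dotProduct_ne_zero ha) (fun u hu => hu)
    (∏ i, X i - ∑ c : NB a, fracEval c.vec (fun i => X (c.1 i)) (p c)) (fun u hu => by
      have := hp.sum_fracEval u hu
      rw [map_sub, sub_eq_zero]
      trans (dProd a u)⁻¹
      · simp [dProd]
      rw [this, map_sum]
      refine Finset.sum_congr rfl fun c _ => ?_
      exact (eval_fracEval_X c u (p c)).symm)
  simp only [map_sub, map_prod, map_sum, map_fracEval, aeval_X, sub_eq_zero] at h1
  set l := (List.finRange N).filter (fun i => i ∈ Y)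
  have hprod : (l.map fun i => b.form (a i)).prod = ∏ i ∈ Y, b.form (a i) := by
    rw [← List.prod_toFinset _ ((List.nodup_finRange N).filter _)]
    congr 1
    ext i
    simp
  have h2 := congrArg (fun f => (l.map fun i => b.form (a i)).prod * f) h1
  simp only [Finset.mul_sum] at h2
  apply pullback_injective b.basis
  rw [map_zero, NB.coe_basis]
  ext k
  have h3 := congrArg (fun f => polarCoeff f k) h2
  simp only [polarCoeff_sum] at h3
  rw [Finset.sum_eq_single b] at h3
  · replace h3 := h3.trans
      (polarCoeff_list_prod_mul b l _ (p b) (polarCoeff_fracEval_self b (p b)) k)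
    have h4 : polarCoeff ((l.map fun i => b.form (a i)).prod * ∏ i, (b.form (a i))⁻¹) k = 0 := by
      obtain ⟨j, hj⟩ := exists_forall_not_isLead_of_span_ne_top b hY
      have h5 : (l.map fun i => b.form (a i)).prod * ∏ i, (b.form (a i))⁻¹ =
          ∏ i ∈ Yᶜ, (b.form (a i))⁻¹ := by
        rw [hprod, ← Finset.prod_mul_prod_compl Y, ← mul_assoc, ← Finset.prod_mul_distrib]
        rw [Finset.prod_congr rfl fun i _ => mul_inv_cancel₀ (b.form_ne_zero (ha i))]
        simp
      rw [h5]
      refine polarCoeff_of_mem_regularAt (j := j) (Subalgebra.prod_mem _ fun i hi => ?_) k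
      exact b.inv_form_mem_regularAt (ha i) (hj i (by simpa using hi))
    rw [h4] at h3
    rw [coeff_zero]
    exact (mul_eq_zero.1 h3.symm).resolve_left (pow_ne_zero _ (by norm_num))
  · intro c _ hc
    obtain ⟨j, hj⟩ := exists_fracEval_mem_regularAt ha (Ne.symm hc) (p c)
    refine polarCoeff_of_mem_regularAt (j := j) (Subalgebra.mul_mem _ ?_ hj) k
    rw [hprod]
    exact Subalgebra.prod_mem _ fun i _ => lexForm_mem_regularAt _ j
  · simp

end Uniqueness

end Spline

end

noncomputable section

open scoped Classical
open MeasureTheory Filter Topology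

namespace Spline

/-! ### Cones, and a functional positive on the family. -/

section Cones

variable {ι : Type*} [Fintype ι] {s : ℕ}

lemma sum_smul_mem_cone (v : ι → Fin s → ℝ) {t : ι → ℝ} (ht : ∀ i, 0 ≤ t i) :
    ∑ i, t i • v i ∈ cone v := ⟨t, ht, rfl⟩

lemma vec_mem_cone (v : ι → Fin s → ℝ) (i : ι) : v i ∈ cone v :=
  ⟨Pi.single i 1, fun j => by
    by_cases h : j = i
    · simp [h]
    · simp [h], by simp [Pi.single_apply]⟩

lemma add_mem_cone {v : ι → Fin s → ℝ} {x y : Fin s → ℝ} (hx : x ∈ cone v) (hy : y ∈ cone v) :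
    x + y ∈ cone v := by
  obtain ⟨t, ht, rfl⟩ := hx
  obtain ⟨r, hr, rfl⟩ := hy
  exact ⟨t + r, fun i => add_nonneg (ht i) (hr i), by
    simp [add_smul, Finset.sum_add_distrib]⟩

lemma smul_mem_cone {v : ι → Fin s → ℝ} {x : Fin s → ℝ} (hx : x ∈ cone v) {r : ℝ} (hr : 0 ≤ r) :
    r • x ∈ cone v := by
  obtain ⟨t, ht, rfl⟩ := hx
  exact ⟨r • t, fun i => mul_nonneg hr (ht i), by simp [Finset.smul_sum, smul_smul]⟩

lemma convex_cone (v : ι → Fin s → ℝ) : Convex ℝ (cone v) :=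
  fun _ hx _ hy _ _ hp hq _ => add_mem_cone (smul_mem_cone hx hp) (smul_mem_cone hy hq)

lemma cone_comp_subset {κ : Type*} [Fintype κ] (v : ι → Fin s → ℝ) (f : κ → ι) :
    cone (v ∘ f) ⊆ cone v := by
  rintro _ ⟨t, ht, rfl⟩
  refine Finset.sum_induction _ (· ∈ cone v) (fun _ _ => add_mem_cone)
    ⟨0, fun i => le_rfl, by simp⟩ fun i _ => smul_mem_cone (vec_mem_cone v (f i)) (ht i)

lemma mem_cone_basis_iff (B : Module.Basis ι ℝ (Fin s → ℝ)) (x : Fin s → ℝ) :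
    x ∈ cone B ↔ ∀ i, 0 ≤ B.equivFun x i := by
  constructor
  · rintro ⟨t, ht, rfl⟩ i
    rw [← B.equivFun_symm_apply, LinearEquiv.apply_symm_apply]
    exact ht i
  · intro h
    exact ⟨B.equivFun x, h, (B.sum_equivFun x).symm⟩

lemma continuous_equivFun_apply (B : Module.Basis ι ℝ (Fin s → ℝ)) (i : ι) :
    Continuous fun x => B.equivFun x i :=
  (continuous_apply i).comp B.equivFun.toLinearMap.continuous_of_finiteDimensional

lemma isClosed_cone_basis (B : Module.Basis ι ℝ (Fin s → ℝ)) : IsClosed (cone B) := by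
  have : cone B = ⋂ i, {x | 0 ≤ B.equivFun x i} := by
    ext x
    simp [mem_cone_basis_iff B x]
  rw [this]
  exact isClosed_iInter fun i => isClosed_le continuous_const (continuous_equivFun_apply B i)

lemma interior_cone_basis_nonempty (B : Module.Basis ι ℝ (Fin s → ℝ)) :
    (interior (cone B)).Nonempty := by
  have ho : IsOpen (⋂ i, {x | 0 < B.equivFun x i}) :=
    isOpen_iInter_of_finite fun i => isOpen_lt continuous_const (continuous_equivFun_apply B i)
  refine ⟨B.equivFun.symm fun _ => 1, interior_maximal (fun x hx => ?_) ho ?_⟩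
  · rw [mem_cone_basis_iff]
    intro i
    exact le_of_lt (Set.mem_iInter.1 hx i)
  · simp only [Set.mem_iInter]
    intro i
    change 0 < B.equivFun (B.equivFun.symm fun _ => 1) i
    rw [LinearEquiv.apply_symm_apply]
    exact one_pos

lemma continuous_dotProduct_left (u : Fin s → ℝ) : Continuous fun x : Fin s → ℝ => x ⬝ᵥ u := by
  simp only [dotProduct]
  fun_prop

lemma continuous_dotProduct_right (u : Fin s → ℝ) : Continuous fun x : Fin s → ℝ => u ⬝ᵥ x := by
  simp only [dotProduct]
  fun_prop

lemma continuous_sum_smul (v : ι → Fin s → ℝ) : Continuous fun t : ι → ℝ => ∑ i, t i • v i := by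
  fun_prop

lemma dotProduct_nonneg_of_mem_cone {v : ι → Fin s → ℝ} {u x : Fin s → ℝ}
    (hu : ∀ i, 0 ≤ v i ⬝ᵥ u) (hx : x ∈ cone v) : 0 ≤ x ⬝ᵥ u := by
  obtain ⟨t, ht, rfl⟩ := hx
  rw [sum_dotProduct]
  exact Finset.sum_nonneg fun i _ => by
    rw [smul_dotProduct]
    exact mul_nonneg (ht i) (hu i)

lemma coord_le_of_sum_smul {v : ι → Fin s → ℝ} {u : Fin s → ℝ} (hu : ∀ i, 0 < v i ⬝ᵥ u)
    {t : ι → ℝ} (ht : ∀ i, 0 ≤ t i) {R : ℝ} (hR : (∑ i, t i • v i) ⬝ᵥ u ≤ R) (i : ι) :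
    t i ≤ R / (v i ⬝ᵥ u) := by
  rw [le_div_iff₀ (hu i)]
  refine le_trans ?_ hR
  rw [sum_dotProduct]
  simp only [smul_dotProduct, smul_eq_mul]
  exact Finset.single_le_sum (f := fun i => t i * (v i ⬝ᵥ u))
    (fun j _ => mul_nonneg (ht j) (hu j).le) (Finset.mem_univ i)

/-- A bound on `x ⬝ᵥ u` bounds all coefficients, so truncations of the cone lie in images of compact
boxes. -/
lemma isClosed_cone {v : ι → Fin s → ℝ} {u : Fin s → ℝ} (hu : ∀ i, 0 < v i ⬝ᵥ u) :
    IsClosed (cone v) := by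
  rw [← closure_subset_iff_isClosed]
  intro x hx
  let K : Set (Fin s → ℝ) := (fun t : ι → ℝ => ∑ i, t i • v i) ''
    Set.Icc 0 (fun i => (x ⬝ᵥ u + 1) / (v i ⬝ᵥ u))
  have hK : IsCompact K := isCompact_Icc.image (continuous_sum_smul v)
  have hO : IsOpen {y : Fin s → ℝ | y ⬝ᵥ u < x ⬝ᵥ u + 1} :=
    isOpen_lt (continuous_dotProduct_left u) continuous_const
  have h1 : x ∈ closure ({y : Fin s → ℝ | y ⬝ᵥ u < x ⬝ᵥ u + 1} ∩ cone v) :=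
    hO.inter_closure ⟨lt_add_one (x ⬝ᵥ u), hx⟩
  have h2 : {y : Fin s → ℝ | y ⬝ᵥ u < x ⬝ᵥ u + 1} ∩ cone v ⊆ K := by
    rintro _ ⟨hy, t, ht, rfl⟩
    exact ⟨t, ⟨ht, coord_le_of_sum_smul hu ht (le_of_lt hy)⟩, rfl⟩
  obtain ⟨t, ht, rfl⟩ := (closure_minimal h2 hK.isClosed) h1
  exact sum_smul_mem_cone v ht.1

/-- Gordan's alternative: a finite family whose convex hull avoids the origin lies in an open
half space. -/
lemma exists_forall_dotProduct_pos {v : ι → Fin s → ℝ}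
    (h0 : (0 : Fin s → ℝ) ∉ convexHull ℝ (Set.range v)) :
    ∃ u : Fin s → ℝ, ∀ i, 0 < v i ⬝ᵥ u := by
  obtain ⟨f, c, hf0, hf⟩ := geometric_hahn_banach_point_closed (convex_convexHull ℝ (Set.range v))
    ((Set.finite_range v).isClosed_convexHull ℝ) h0
  refine ⟨fun j => f (Pi.single j 1), fun i => ?_⟩
  have h1 : f (v i) = v i ⬝ᵥ fun j => f (Pi.single j 1) := by
    conv_lhs => rw [← (Pi.basisFun ℝ (Fin s)).sum_repr (v i)]
    simp [dotProduct]
  rw [← h1]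
  rw [map_zero] at hf0
  exact hf0.trans (hf _ (subset_convexHull ℝ _ ⟨i, rfl⟩))

end Cones

/-! ### Fiber volumes and their continuity. -/

section Existence

variable {s : ℕ} {Q R : Type} [Fintype Q] [Fintype R]
  (B : Module.Basis Q ℝ (Fin s → ℝ)) (w : R → Fin s → ℝ)

/-- The polytope of the nonnegative `t` with `x - ∑ t_r w_r` in the cone of the basis `B`. -/
def fiberPolytope (x : Fin s → ℝ) : Set (R → ℝ) :=
  {t | (∀ r, 0 ≤ t r) ∧ ∀ q, 0 ≤ B.equivFun (x - ∑ r, t r • w r) q}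

lemma isClosed_fiberGraph :
    IsClosed {z : (Fin s → ℝ) × (R → ℝ) | z.2 ∈ fiberPolytope B w z.1} := by
  have h1 : IsClosed {z : (Fin s → ℝ) × (R → ℝ) | ∀ r, 0 ≤ z.2 r} := by
    rw [Set.ofPred_forall]
    exact isClosed_iInter fun r => isClosed_le continuous_const (by fun_prop)
  have h2 : IsClosed {z : (Fin s → ℝ) × (R → ℝ) |
      ∀ q, 0 ≤ B.equivFun (z.1 - ∑ r, z.2 r • w r) q} := by
    rw [Set.ofPred_forall]
    exact isClosed_iInter fun q => isClosed_le continuous_const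
      ((continuous_equivFun_apply B q).comp (by fun_prop))
  exact h1.inter h2

lemma measurableSet_fiberPolytope (x : Fin s → ℝ) : MeasurableSet (fiberPolytope B w x) :=
  ((isClosed_fiberGraph B w).preimage (Continuous.prodMk_right x)).measurableSet

lemma measurable_volume_fiberPolytope : Measurable fun x => volume (fiberPolytope B w x) :=
  measurable_measure_prodMk_left (isClosed_fiberGraph B w).measurableSet

lemma fiberPolytope_subset_Icc {u : Fin s → ℝ} (hB : ∀ q, 0 < B q ⬝ᵥ u) (hw : ∀ r, 0 < w r ⬝ᵥ u)
    {x : Fin s → ℝ} {c : ℝ} (hx : x ⬝ᵥ u ≤ c) :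
    fiberPolytope B w x ⊆ Set.Icc 0 (fun r => c / (w r ⬝ᵥ u)) := by
  intro t ht
  refine ⟨ht.1, coord_le_of_sum_smul hw ht.1 (le_trans ?_ hx)⟩
  have := dotProduct_nonneg_of_mem_cone (fun q => (hB q).le)
    ((mem_cone_basis_iff B _).2 ht.2)
  rw [sub_dotProduct] at this
  linarith

lemma volume_fiberPolytope_lt_top {u : Fin s → ℝ} (hB : ∀ q, 0 < B q ⬝ᵥ u)
    (hw : ∀ r, 0 < w r ⬝ᵥ u) (x : Fin s → ℝ) : volume (fiberPolytope B w x) < ⊤ :=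
  (measure_mono (fiberPolytope_subset_Icc B w hB hw le_rfl)).trans_lt
    isCompact_Icc.measure_lt_top

lemma volume_level_eq_zero {E : Type*} [NormedAddCommGroup E] [NormedSpace ℝ E]
    [MeasurableSpace E] [BorelSpace E] [FiniteDimensional ℝ E] (μ : Measure E)
    [μ.IsAddHaarMeasure] (f : E →ₗ[ℝ] ℝ) (hf : f ≠ 0) (c : ℝ) : μ {t | f t = c} = 0 := by
  by_cases hne : ∃ t, f t = c
  · obtain ⟨t₀, h₀⟩ := hne
    have h1 : {t | f t = c} = (fun t => t + -t₀) ⁻¹' (LinearMap.ker f : Set E) := by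
      ext t
      simp [h₀, add_neg_eq_zero]
    rw [h1, measure_preimage_add_right]
    exact Measure.addHaar_submodule μ _ fun h => hf (LinearMap.ker_eq_top.1 h)
  · have : {t | f t = c} = ∅ := by
      ext t
      simpa using fun h => hne ⟨t, h⟩
    rw [this, measure_empty]

/-- If the `q`-th coordinate vanishes on all the `w_r`, it is nonnegative on the cone of the
joint family. -/
lemma coord_nonneg_of_coord_eq_zero {q : Q} (hq : ∀ r, B.equivFun (w r) q = 0) {x : Fin s → ℝ}
    (hx : x ∈ cone (Sum.elim B w)) : 0 ≤ B.equivFun x q := by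
  obtain ⟨t, ht, rfl⟩ := hx
  rw [Fintype.sum_sum_type]
  simp only [Sum.elim_inl, Sum.elim_inr, map_add, map_sum, map_smul, Pi.add_apply,
    Finset.sum_apply, Pi.smul_apply, hq, smul_zero, Finset.sum_const_zero, add_zero]
  exact Finset.sum_nonneg fun i _ => by
    rw [B.equivFun_self]
    split_ifs <;> simp [ht]

lemma mem_cone_of_mem_fiberPolytope {x : Fin s → ℝ} {t : R → ℝ} (ht : t ∈ fiberPolytope B w x) :
    x ∈ cone (Sum.elim B w) := by
  refine ⟨Sum.elim (B.equivFun (x - ∑ r, t r • w r)) t, ?_, ?_⟩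
  · rintro (q | r)
    · exact ht.2 q
    · exact ht.1 r
  · rw [Fintype.sum_sum_type]
    simp only [Sum.elim_inl, Sum.elim_inr]
    rw [B.sum_equivFun, sub_add_cancel]

/-- The volume of the fiber polytope varies continuously with the point of the cone. -/
lemma continuousOn_volume_fiberPolytope {u : Fin s → ℝ} (hB : ∀ q, 0 < B q ⬝ᵥ u)
    (hw : ∀ r, 0 < w r ⬝ᵥ u) :
    ContinuousOn (fun x => volume.real (fiberPolytope B w x)) (cone (Sum.elim B w)) := by
  have h1 : (fun x => volume.real (fiberPolytope B w x)) =
      fun x => ∫ t, (fiberPolytope B w x).indicator (1 : (R → ℝ) → ℝ) t := by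
    funext x
    rw [integral_indicator_one (measurableSet_fiberPolytope B w x)]
  rw [h1]
  intro x₀ hx₀
  refine continuousWithinAt_of_dominated
    (bound := (Set.Icc 0 (fun r => (x₀ ⬝ᵥ u + 1) / (w r ⬝ᵥ u))).indicator 1) ?_ ?_ ?_ ?_
  · exact Eventually.of_forall fun x => (measurable_one.indicator
      (measurableSet_fiberPolytope B w x)).aestronglyMeasurable
  · have h2 : ∀ᶠ x in 𝓝 x₀, x ⬝ᵥ u < x₀ ⬝ᵥ u + 1 :=
      (continuous_dotProduct_left u).continuousAt.eventually_lt continuousAt_const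
        (lt_add_one _)
    filter_upwards [h2.filter_mono nhdsWithin_le_nhds] with x hx
    refine Eventually.of_forall fun t => ?_
    rw [norm_indicator_eq_indicator_norm]
    simp only [Pi.one_apply, norm_one]
    exact Set.indicator_le_indicator_of_subset (fiberPolytope_subset_Icc B w hB hw hx.le)
      (fun _ => zero_le_one) t
  · exact (integrable_indicator_iff measurableSet_Icc).2
      (integrableOn_const isCompact_Icc.measure_lt_top.ne)
  -- A constraint that depends on `t` is an equality only on a hyperplane, a null set. Off it, the
  -- sign of the constraint is locally constant in `x`.
  · have h3 : ∀ᵐ t : R → ℝ, ∀ q, (¬ ∀ r, B.equivFun (w r) q = 0) →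
        B.equivFun (x₀ - ∑ r, t r • w r) q ≠ 0 := by
      rw [ae_all_iff]
      intro q
      by_cases hq : ∀ r, B.equivFun (w r) q = 0
      · exact Eventually.of_forall fun t h => absurd hq h
      · let f : (R → ℝ) →ₗ[ℝ] ℝ :=
          LinearMap.proj q ∘ₗ B.equivFun.toLinearMap ∘ₗ Fintype.linearCombination ℝ w
        have hf : ∀ t, f t = B.equivFun (∑ r, t r • w r) q := fun t => rfl
        have hf0 : f ≠ 0 := by
          intro h
          apply hq
          intro r
          have := LinearMap.congr_fun h (Pi.single r 1)
          rw [hf] at this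
          simpa [Pi.single_apply] using this
        have h4 := volume_level_eq_zero (volume : Measure (R → ℝ)) f hf0 (B.equivFun x₀ q)
        filter_upwards [measure_eq_zero_iff_ae_notMem.1 h4] with t ht _ h5
        apply ht
        rw [map_sub, Pi.sub_apply, sub_eq_zero] at h5
        exact h5.symm
    filter_upwards [h3] with t ht
    have h6 : ∀ᶠ x in 𝓝[cone (Sum.elim B w)] x₀,
        (t ∈ fiberPolytope B w x ↔ t ∈ fiberPolytope B w x₀) := by
      have h7 : ∀ q, ∀ᶠ x in 𝓝[cone (Sum.elim B w)] x₀,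
          (0 ≤ B.equivFun (x - ∑ r, t r • w r) q ↔ 0 ≤ B.equivFun (x₀ - ∑ r, t r • w r) q) := by
        intro q
        by_cases hq : ∀ r, B.equivFun (w r) q = 0
        -- A constraint independent of `t` holds on the whole cone but may fail just outside, so
        -- continuity is relative to the cone.
        · have h8 : ∀ x ∈ cone (Sum.elim B w), 0 ≤ B.equivFun (x - ∑ r, t r • w r) q := by
            intro x hx
            have : B.equivFun (x - ∑ r, t r • w r) q = B.equivFun x q := by
              simp only [map_sub, map_sum, map_smul, Pi.sub_apply, Finset.sum_apply,
                Pi.smul_apply, hq, smul_zero, Finset.sum_const_zero, sub_zero]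
            rw [this]
            exact coord_nonneg_of_coord_eq_zero B w hq hx
          filter_upwards [self_mem_nhdsWithin] with x hx
          exact iff_of_true (h8 x hx) (h8 x₀ hx₀)
        · have hc : ContinuousAt (fun x => B.equivFun (x - ∑ r, t r • w r) q) x₀ :=
            ((continuous_equivFun_apply B q).comp (by fun_prop)).continuousAt
          refine Eventually.filter_mono nhdsWithin_le_nhds ?_
          rcases lt_or_gt_of_ne (ht q hq) with h | h
          · filter_upwards [hc.eventually_lt continuousAt_const h] with x hx
            exact iff_of_false hx.not_ge h.not_ge
          · filter_upwards [continuousAt_const.eventually_lt hc h] with x hx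
            exact iff_of_true hx.le h.le
      filter_upwards [eventually_all.2 h7] with x hx
      exact and_congr_right fun _ => forall_congr' hx
    refine ContinuousWithinAt.congr_of_eventuallyEq
      (f := fun _ => (fiberPolytope B w x₀).indicator (1 : (R → ℝ) → ℝ) t)
      continuousWithinAt_const ?_ rfl
    filter_upwards [h6] with x hx
    simp only [Set.indicator_apply, hx]

/-- The image is a Haar measure, hence a multiple of Lebesgue measure; the value of the constant is
never needed. -/
lemma exists_map_volume_eq_smul :
    ∃ c : NNReal, (volume : Measure (Q → ℝ)).map (fun t => ∑ q, t q • B q) =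
      (c : ENNReal) • (volume : Measure (Fin s → ℝ)) := by
  have h1 : (fun t : Q → ℝ => ∑ q, t q • B q) =
      (B.equivFun.symm.toContinuousLinearEquiv : (Q → ℝ) → Fin s → ℝ) := by
    funext t
    exact (B.equivFun_symm_apply t).symm
  rw [h1]
  have h2 : ((volume : Measure (Q → ℝ)).map
      (B.equivFun.symm.toContinuousLinearEquiv : (Q → ℝ) → Fin s → ℝ)).IsAddHaarMeasure :=
    ContinuousLinearEquiv.isAddHaarMeasure_map B.equivFun.symm.toContinuousLinearEquiv volume
  exact ⟨_, Measure.isAddLeftInvariant_eq_smul _ volume⟩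

/-- Tonelli is used twice: for fixed second coordinate a translation and the linear change of
variables bring in `x`, and the resulting set is then sliced at fixed `x`. -/
lemma volume_prod_eq_setLIntegral {c : NNReal}
    (hc : (volume : Measure (Q → ℝ)).map (fun t => ∑ q, t q • B q) =
      (c : ENNReal) • (volume : Measure (Fin s → ℝ))) {W : Set (Fin s → ℝ)}
    (hW : MeasurableSet W) :
    ((volume : Measure (Q → ℝ)).prod (volume : Measure (R → ℝ)))
      {z | (∀ q, 0 ≤ z.1 q) ∧ (∀ r, 0 ≤ z.2 r) ∧ ∑ q, z.1 q • B q + ∑ r, z.2 r • w r ∈ W} =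
      ∫⁻ x in W, (c : ENNReal) * volume (fiberPolytope B w x) := by
  set D : Set ((Fin s → ℝ) × (R → ℝ)) := {z | z.2 ∈ fiberPolytope B w z.1 ∧ z.1 ∈ W} with hD
  have hDm : MeasurableSet D :=
    (isClosed_fiberGraph B w).measurableSet.inter (measurable_fst hW)
  have hm : MeasurableSet {z : (Q → ℝ) × (R → ℝ) | (∀ q, 0 ≤ z.1 q) ∧ (∀ r, 0 ≤ z.2 r) ∧
      ∑ q, z.1 q • B q + ∑ r, z.2 r • w r ∈ W} := by
    have h1 : IsClosed {z : (Q → ℝ) × (R → ℝ) | ∀ q, 0 ≤ z.1 q} := by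
      rw [Set.ofPred_forall]
      exact isClosed_iInter fun q => isClosed_le continuous_const (by fun_prop)
    have h2 : IsClosed {z : (Q → ℝ) × (R → ℝ) | ∀ r, 0 ≤ z.2 r} := by
      rw [Set.ofPred_forall]
      exact isClosed_iInter fun q => isClosed_le continuous_const (by fun_prop)
    have h3 : Continuous fun z : (Q → ℝ) × (R → ℝ) => ∑ q, z.1 q • B q + ∑ r, z.2 r • w r := by
      fun_prop
    exact h1.measurableSet.inter (h2.measurableSet.inter (h3.measurable hW))
  have hslice : ∀ t : R → ℝ, MeasurableSet ((fun x : Fin s → ℝ => (x, t)) ⁻¹' D) := fun t =>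
    measurable_prodMk_right hDm
  rw [Measure.prod_apply_symm hm]
  have h4 : ∀ t : R → ℝ, volume ((fun z : Q → ℝ => (z, t)) ⁻¹'
      {z : (Q → ℝ) × (R → ℝ) | (∀ q, 0 ≤ z.1 q) ∧ (∀ r, 0 ≤ z.2 r) ∧
        ∑ q, z.1 q • B q + ∑ r, z.2 r • w r ∈ W}) =
      c * volume ((fun x : Fin s → ℝ => (x, t)) ⁻¹' D) := by
    intro t
    rw [← measure_preimage_add_right volume (∑ r, t r • w r)
      ((fun x : Fin s → ℝ => (x, t)) ⁻¹' D), ← smul_eq_mul, ← Measure.smul_apply, ← hc,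
      Measure.map_apply (continuous_sum_smul _).measurable
        ((measurable_add_const _) (hslice t))]
    congr 1
    ext z
    simp only [hD, fiberPolytope, Set.mem_preimage, Set.mem_ofPred_eq, add_sub_cancel_right]
    rw [← B.equivFun_symm_apply, LinearEquiv.apply_symm_apply]
    tauto
  simp only [h4]
  rw [lintegral_const_mul' _ _ ENNReal.coe_ne_top,
    lintegral_const_mul' _ _ ENNReal.coe_ne_top, ← Measure.prod_apply_symm hDm,
    Measure.prod_apply hDm, ← lintegral_indicator hW]
  congr 2
  funext x
  by_cases hx : x ∈ W
  · rw [Set.indicator_of_mem hx]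
    congr 1
    ext t
    simp [hD, hx]
  · rw [Set.indicator_of_notMem hx]
    convert measure_empty (μ := (volume : Measure (R → ℝ)))
    ext t
    simp [hD, hx]

end Existence

/-! ### Existence and uniqueness of the spline. -/

section Density

variable {s N : ℕ} {a : Fin N → Fin s → ℝ}

lemma cone_comp_equiv {ι κ : Type*} [Fintype ι] [Fintype κ] (v : ι → Fin s → ℝ) (e : κ ≃ ι) :
    cone (v ∘ e) = cone v := by
  refine Set.Subset.antisymm (cone_comp_subset v e) ?_
  have := cone_comp_subset (v ∘ e) e.symm
  rwa [Function.comp_assoc, e.self_comp_symm, Function.comp_id] at this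

/-- `T` is a density of the image of Lebesgue measure on the orthant. -/
structure IsSplineDensity (a : Fin N → Fin s → ℝ) (T : (Fin s → ℝ) → ℝ) : Prop where
  measurable : Measurable T
  nonneg : ∀ x, 0 ≤ T x
  map_eq : (volume.restrict {t : Fin N → ℝ | ∀ i, 0 ≤ t i}).map (fun t => ∑ i, t i • a i) =
    volume.withDensity (fun x => ENNReal.ofReal (T x))

/-- Split the coordinates of the orthant into those of a basis drawn from the family and the rest.
The density at `x` is then a constant times the volume of the fiber polytope in the remaining
coordinates. -/
lemma exists_isSplineDensity (B₀ : Module.Basis (Fin s) ℝ (Fin s → ℝ)) (β : Fin s ↪ Fin N)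
    (hβ : ∀ j, B₀ j = a (β j)) {u : Fin s → ℝ} (hu : ∀ i, 0 < a i ⬝ᵥ u) :
    ∃ T : (Fin s → ℝ) → ℝ, (∀ x, x ∉ cone a → T x = 0) ∧ ContinuousOn T (cone a) ∧
      IsSplineDensity a T := by
  obtain ⟨p, hp⟩ : ∃ p : Fin N → Prop, ∀ i, i ∈ Set.range β ↔ p i := ⟨_, fun i => Iff.rfl⟩
  let e : Fin s ≃ {i // p i} :=
    (Equiv.ofInjective β β.injective).trans (Equiv.subtypeEquivRight hp)
  let B : Module.Basis {i // p i} ℝ (Fin s → ℝ) := B₀.reindex e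
  have hB : ∀ q, B q = a q := by
    intro q
    rw [Module.Basis.reindex_apply, hβ]
    exact congrArg a (Equiv.apply_ofInjective_symm β.injective
      ((Equiv.subtypeEquivRight hp).symm q))
  let w : {i // ¬ p i} → Fin s → ℝ := fun r => a r
  have hcone : cone (Sum.elim B w) = cone a := by
    have : Sum.elim B w = a ∘ Equiv.sumCompl p := by
      funext z
      rcases z with q | r
      · exact hB q
      · rfl
    rw [this, cone_comp_equiv]
  have hBu : ∀ q, 0 < B q ⬝ᵥ u := fun q => by rw [hB]; exact hu _
  have hwu : ∀ r, 0 < w r ⬝ᵥ u := fun r => hu _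
  obtain ⟨c, hc⟩ := exists_map_volume_eq_smul B
  refine ⟨fun x => c * volume.real (fiberPolytope B w x), ?_, ?_, ?_, ?_, ?_⟩
  · intro x hx
    have : fiberPolytope B w x = ∅ := by
      ext t
      simp only [Set.mem_empty_iff_false, iff_false]
      exact fun ht => hx (hcone ▸ mem_cone_of_mem_fiberPolytope B w ht)
    simp [this]
  · rw [← hcone]
    exact (continuousOn_volume_fiberPolytope B w hBu hwu).const_smul (c : ℝ)
  · exact ((measurable_volume_fiberPolytope B w).ennreal_toReal).const_mul _
  · exact fun x => mul_nonneg c.2 measureReal_nonneg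
  · ext W hW
    have hφ : Measurable fun t : Fin N → ℝ => ∑ i, t i • a i := (continuous_sum_smul a).measurable
    rw [Measure.map_apply hφ hW, Measure.restrict_apply (hφ hW), withDensity_apply _ hW]
    have h1 : ∀ x, ENNReal.ofReal (c * volume.real (fiberPolytope B w x)) =
        (c : ENNReal) * volume (fiberPolytope B w x) := by
      intro x
      rw [ENNReal.ofReal_mul c.coe_nonneg, ENNReal.ofReal_coe_nnreal, measureReal_def,
        ENNReal.ofReal_toReal (volume_fiberPolytope_lt_top B w hBu hwu x).ne]
    simp only [h1]
    rw [← volume_prod_eq_setLIntegral B w hc hW]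
    have h2 := volume_preserving_piEquivPiSubtypeProd (fun _ : Fin N => ℝ) p
    rw [← Measure.volume_eq_prod]
    refine Eq.trans ?_ (h2.measure_preimage_equiv _)
    congr 1
    ext t
    have h3 : ∑ q : {i // p i}, t q • B q + ∑ r : {i // ¬ p i}, t r • w r = ∑ i, t i • a i := by
      rw [← Fintype.sum_subtype_add_sum_subtype p]
      simp only [hB, w]
    have h4 : (∀ i, 0 ≤ t i) ↔ (∀ q : {i // p i}, 0 ≤ t q) ∧ (∀ r : {i // ¬ p i}, 0 ≤ t r) :=
      ⟨fun h => ⟨fun q => h q, fun r => h r⟩, fun h i =>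
        if hi : p i then h.1 ⟨i, hi⟩ else h.2 ⟨i, hi⟩⟩
    change (∑ i, t i • a i ∈ W ∧ ∀ i, 0 ≤ t i) ↔ (∀ q : {i // p i}, 0 ≤ t q) ∧
      (∀ r : {i // ¬ p i}, 0 ≤ t r) ∧
        ∑ q : {i // p i}, t q • B q + ∑ r : {i // ¬ p i}, t r • w r ∈ W
    rw [h3, h4]
    tauto

lemma IsSplineDensity.integral_eq {T : (Fin s → ℝ) → ℝ} (hT : IsSplineDensity a T)
    {f : (Fin s → ℝ) → ℝ} (hf : Continuous f) :
    ∫ x, f x * T x = ∫ t in {t : Fin N → ℝ | ∀ i, 0 ≤ t i}, f (∑ i, t i • a i) := by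
  rw [← integral_map (continuous_sum_smul a).measurable.aemeasurable hf.aestronglyMeasurable,
    hT.map_eq, integral_withDensity_eq_integral_toReal_smul hT.measurable.ennreal_ofReal
      (Eventually.of_forall fun x => ENNReal.ofReal_lt_top)]
  refine integral_congr_ae (Eventually.of_forall fun x => ?_)
  simp only [ENNReal.toReal_ofReal (hT.nonneg x), smul_eq_mul, mul_comm]

lemma IsSplineDensity.integrable_iff {T : (Fin s → ℝ) → ℝ} (hT : IsSplineDensity a T)
    {f : (Fin s → ℝ) → ℝ} (hf : Continuous f) :
    Integrable (fun x => f x * T x) ↔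
      IntegrableOn (fun t : Fin N → ℝ => f (∑ i, t i • a i)) {t | ∀ i, 0 ≤ t i} := by
  have h1 := integrable_map_measure (μ := volume.restrict {t : Fin N → ℝ | ∀ i, 0 ≤ t i})
    (f := fun t => ∑ i, t i • a i) (g := f) hf.aestronglyMeasurable
    (continuous_sum_smul a).measurable.aemeasurable
  rw [hT.map_eq, integrable_withDensity_iff_integrable_smul' hT.measurable.ennreal_ofReal
      (Eventually.of_forall fun x => ENNReal.ofReal_lt_top)] at h1
  simp only [ENNReal.toReal_ofReal (hT.nonneg _), smul_eq_mul] at h1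
  simp only [mul_comm]
  exact h1

lemma IsSplineDensity.isMultivariateSpline {T : (Fin s → ℝ) → ℝ} (hT : IsSplineDensity a T)
    (h0 : ∀ x, x ∉ cone a → T x = 0) (hc : ContinuousOn T (cone a)) :
    IsMultivariateSpline a T :=
  ⟨h0, hc, fun _ hf _ => hT.integral_eq hf⟩

lemma IsMultivariateSpline.locallyIntegrable {T : (Fin s → ℝ) → ℝ}
    (hT : IsMultivariateSpline a T) (hclosed : IsClosed (cone a)) : LocallyIntegrable T := by
  rw [locallyIntegrable_iff]
  intro K hK
  have h1 : IntegrableOn T (K ∩ cone a) :=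
    ContinuousOn.integrableOn_compact (hK.inter_right hclosed)
      (hT.continuousOn.mono Set.inter_subset_right)
  refine h1.of_forall_sdiff_eq_zero hK.measurableSet fun x hx => ?_
  exact hT.eq_zero_of_notMem x fun h => hx.2 ⟨hx.1, h⟩

lemma subset_closure_interior_cone (b : NB a) : cone a ⊆ closure (interior (cone a)) := by
  have h1 : cone b.basis ⊆ cone a := by
    rw [NB.coe_basis]
    exact cone_comp_subset a b.1
  rw [(convex_cone a).closure_interior_eq_closure_of_nonempty_interior
    ((interior_cone_basis_nonempty b.basis).mono (interior_mono h1))]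
  exact subset_closure

/-- Test functions give equality almost everywhere, continuity gives it on the interior, and the
cone lies in the closure of its interior. -/
lemma IsMultivariateSpline.unique (b : NB a) (hclosed : IsClosed (cone a))
    {T T' : (Fin s → ℝ) → ℝ} (hT : IsMultivariateSpline a T) (hT' : IsMultivariateSpline a T') :
    T = T' := by
  have h1 : T =ᵐ[volume] T' := by
    refine ae_eq_of_integral_contDiff_smul_eq (hT.locallyIntegrable hclosed)
      (hT'.locallyIntegrable hclosed) fun g hg hgs => ?_
    simp only [smul_eq_mul]
    rw [hT.integral_eq g hg.continuous hgs, hT'.integral_eq g hg.continuous hgs]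
  have h2 : Set.EqOn T T' (interior (cone a)) :=
    Measure.eqOn_open_of_ae_eq (ae_restrict_of_ae h1) isOpen_interior
      (hT.continuousOn.mono interior_subset) (hT'.continuousOn.mono interior_subset)
  have h3 : Set.EqOn T T' (cone a) := h2.of_subset_closure hT.continuousOn hT'.continuousOn
    interior_subset (subset_closure_interior_cone b)
  funext x
  by_cases hx : x ∈ cone a
  · exact h3 hx
  · rw [hT.eq_zero_of_notMem x hx, hT'.eq_zero_of_notMem x hx]

/-- With no such basis, the expansion would be an empty sum equal to the nonzero value `1/d_X`. -/
lemma nonempty_NB (ha : ∀ i, a i ≠ 0) (hspan : Submodule.span ℝ (Set.range a) = ⊤) :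
    Nonempty (NB a) := by
  by_contra hne
  rw [not_nonempty_iff] at hne
  obtain ⟨p, -, hp⟩ := exists_isPartialFractionExpansion hspan
  obtain ⟨u, hu⟩ := nonempty_dotProduct_ne_zero ha
  have := hp u hu
  rw [Finset.univ_eq_empty, Finset.sum_empty, inv_eq_zero] at this
  exact Finset.prod_ne_zero_iff.2 (fun i _ => hu i) this

end Density

/-! ### Gamma integrals on the orthant. -/

lemma orthant_eq_pi (ι : Type*) : {t : ι → ℝ | ∀ i, 0 ≤ t i} = Set.univ.pi fun _ => Set.Ici 0 := by
  ext t
  simp only [Set.mem_ofPred_eq, Set.mem_univ_pi, Set.mem_Ici]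

section OrthantIntegrals

variable {ι : Type*} [Fintype ι]

lemma integrableOn_neg_pow_mul_exp {α : ℝ} (hα : 0 < α) (k : ℕ) :
    IntegrableOn (fun t : ℝ => (-t) ^ k * Real.exp (-(α * t))) (Set.Ici 0) := by
  rw [integrableOn_Ici_iff_integrableOn_Ioi]
  have h := (integrableOn_rpow_mul_exp_neg_mul_rpow (p := 1) (s := k) (b := α)
    (by have : (0 : ℝ) ≤ k := Nat.cast_nonneg k
        linarith) one_pos hα).const_mul ((-1 : ℝ) ^ k)
  refine IntegrableOn.congr_fun h (fun t _ => ?_) measurableSet_Ioi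
  simp only [Real.rpow_natCast, Real.rpow_one]
  rw [neg_pow t k]
  ring_nf

lemma integral_neg_pow_mul_exp {α : ℝ} (hα : 0 < α) (k : ℕ) :
    ∫ t in Set.Ici (0 : ℝ), (-t) ^ k * Real.exp (-(α * t)) =
      ((-1 : ℝ) ^ k * (k.factorial : ℝ)) * α⁻¹ ^ (k + 1) := by
  have h := Real.integral_rpow_mul_exp_neg_mul_Ioi (a := k + 1) (r := α) (by positivity) hα
  rw [integral_Ici_eq_integral_Ioi]
  have h1 : ∀ t : ℝ, (-t) ^ k * Real.exp (-(α * t)) =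
      (-1 : ℝ) ^ k * (t ^ ((k : ℝ) + 1 - 1) * Real.exp (-(α * t))) := by
    intro t
    rw [add_sub_cancel_right, Real.rpow_natCast, neg_pow t k]
    ring
  simp only [h1]
  rw [integral_const_mul, h, Real.Gamma_nat_eq_factorial, one_div]
  have : (α⁻¹ : ℝ) ^ ((k : ℝ) + 1) = α⁻¹ ^ (k + 1) := by
    rw [← Real.rpow_natCast]
    push_cast
    rfl
  rw [this]
  ring

lemma measurableSet_orthant : MeasurableSet {t : ι → ℝ | ∀ i, 0 ≤ t i} := by
  rw [orthant_eq_pi ι]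
  exact MeasurableSet.univ_pi fun _ => measurableSet_Ici

lemma volume_restrict_orthant :
    (volume : Measure (ι → ℝ)).restrict {t : ι → ℝ | ∀ i, 0 ≤ t i} =
      Measure.pi fun _ => (volume : Measure ℝ).restrict (Set.Ici 0) := by
  rw [orthant_eq_pi ι, volume_pi, Measure.restrict_pi_pi]

lemma exp_mul_eval_neg_eq_sum (α : ι → ℝ) (q : MvPolynomial ι ℝ) (t : ι → ℝ) :
    Real.exp (-∑ i, α i * t i) * MvPolynomial.eval (-t) q =
      ∑ k ∈ q.support, q.coeff k * ∏ i, ((-t i) ^ k i * Real.exp (-(α i * t i))) := by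
  rw [MvPolynomial.eval_eq', Finset.mul_sum, ← Finset.sum_neg_distrib, Real.exp_sum]
  refine Finset.sum_congr rfl fun k _ => ?_
  rw [Finset.prod_mul_distrib]
  simp only [Pi.neg_apply]
  ring

lemma integrableOn_orthant_exp_mul_eval {α : ι → ℝ} (hα : ∀ i, 0 < α i) (q : MvPolynomial ι ℝ) :
    IntegrableOn (fun t : ι → ℝ => Real.exp (-∑ i, α i * t i) * MvPolynomial.eval (-t) q)
      {t | ∀ i, 0 ≤ t i} := by
  simp only [exp_mul_eval_neg_eq_sum]
  refine integrable_finsetSum _ fun k _ => Integrable.const_mul ?_ _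
  rw [volume_restrict_orthant]
  exact Integrable.fintype_prod (f := fun i t => (-t) ^ k i * Real.exp (-(α i * t)))
    fun i => integrableOn_neg_pow_mul_exp (hα i) (k i)

/-- The Laplace transform of a polynomial on the orthant. -/
lemma integral_orthant_exp_mul_eval {α : ι → ℝ} (hα : ∀ i, 0 < α i) (q : MvPolynomial ι ℝ) :
    ∫ t in {t : ι → ℝ | ∀ i, 0 ≤ t i}, Real.exp (-∑ i, α i * t i) * MvPolynomial.eval (-t) q =
      symbolEval (fun i => (α i)⁻¹) q := by
  simp only [exp_mul_eval_neg_eq_sum]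
  rw [integral_finsetSum, symbolEval_eq_sum]
  · refine Finset.sum_congr rfl fun k _ => ?_
    rw [integral_const_mul, smul_eq_mul, volume_restrict_orthant,
      integral_fintype_prod_eq_prod (fun i t => (-t) ^ k i * Real.exp (-(α i * t))), invMonomial]
    simp only [integral_neg_pow_mul_exp (hα _)]
  · intro k _
    refine Integrable.const_mul ?_ _
    rw [volume_restrict_orthant]
    exact Integrable.fintype_prod (f := fun i t => (-t) ^ k i * Real.exp (-(α i * t)))
      fun i => integrableOn_neg_pow_mul_exp (hα i) (k i)

end OrthantIntegrals

/-! ### Laplace transforms of the cone pieces and of the spline. -/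

section LaplaceTransform

variable {s N : ℕ} {a : Fin N → Fin s → ℝ}

/-- The contribution of a no broken basis to the local expansion. -/
def conePiece (b : NB a) (p : MvPolynomial (Fin s) ℝ) : (Fin s → ℝ) → ℝ :=
  (cone b.vec).indicator fun x => |(Matrix.of b.vec).det|⁻¹ * MvPolynomial.eval (-x) p

lemma NB.det_ne_zero (b : NB a) : (Matrix.of b.vec).det ≠ 0 := by
  have h : LinearIndependent ℝ (Matrix.of b.vec).row := b.2.1
  exact ((Matrix.isUnit_iff_isUnit_det _).1 (Matrix.linearIndependent_rows_iff_isUnit.1 h)).ne_zero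

lemma NB.isClosed_cone (b : NB a) : IsClosed (cone b.vec) := by
  rw [← NB.coe_basis]
  exact isClosed_cone_basis b.basis

lemma continuous_eval_neg (p : MvPolynomial (Fin s) ℝ) :
    Continuous fun x : Fin s → ℝ => MvPolynomial.eval (-x) p :=
  (MvPolynomial.continuous_eval p).comp continuous_neg

lemma measurable_conePiece (b : NB a) (p : MvPolynomial (Fin s) ℝ) :
    Measurable (conePiece b p) :=
  ((continuous_eval_neg p).measurable.const_mul _).indicator b.isClosed_cone.measurableSet

lemma NB.map_volume (b : NB a) :
    (volume : Measure (Fin s → ℝ)).map b.basis.equivFun.symm =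
      ENNReal.ofReal |(Matrix.of b.vec).det|⁻¹ • (volume : Measure (Fin s → ℝ)) := by
  have h1 : (b.basis.equivFun.symm : (Fin s → ℝ) → Fin s → ℝ) =
      Matrix.toLin' (Matrix.of b.vec).transpose := by
    funext t
    rw [b.basis.equivFun_symm_apply, NB.coe_basis]
    ext j
    simp [Matrix.toLin'_apply, Matrix.mulVec, dotProduct, mul_comm]
  rw [h1, Real.map_matrix_volume_pi_eq_smul_volume_pi (by
    rw [Matrix.det_transpose]; exact b.det_ne_zero), Matrix.det_transpose, abs_inv]

lemma NB.measurableEmbedding (b : NB a) : MeasurableEmbedding b.basis.equivFun.symm :=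
  b.basis.equivFun.symm.toContinuousLinearEquiv.toHomeomorph.measurableEmbedding

lemma conePiece_comp (b : NB a) (p : MvPolynomial (Fin s) ℝ) (u t : Fin s → ℝ) :
    Real.exp (-(b.basis.equivFun.symm t ⬝ᵥ u)) *
      (cone b.vec).indicator (fun x => MvPolynomial.eval (-x) p) (b.basis.equivFun.symm t) =
      {t : Fin s → ℝ | ∀ i, 0 ≤ t i}.indicator (fun t =>
        Real.exp (-∑ i, (b.vec i ⬝ᵥ u) * t i) * MvPolynomial.eval (-t) (pullback b.vec p)) t := by
  have h1 : b.basis.equivFun.symm t ∈ cone b.vec ↔ ∀ i, 0 ≤ t i := by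
    rw [← NB.coe_basis, mem_cone_basis_iff, LinearEquiv.apply_symm_apply]
  by_cases ht : t ∈ {t : Fin s → ℝ | ∀ i, 0 ≤ t i}
  · rw [Set.indicator_of_mem (h1.2 ht), Set.indicator_of_mem ht, eval_pullback,
      b.basis.equivFun_symm_apply, NB.coe_basis, sum_dotProduct]
    simp only [Pi.neg_apply, neg_smul, Finset.sum_neg_distrib, smul_dotProduct, smul_eq_mul,
      mul_comm]
  · rw [Set.indicator_of_notMem (mt h1.1 ht), Set.indicator_of_notMem ht, mul_zero]

lemma conePiece_eq (b : NB a) (p : MvPolynomial (Fin s) ℝ) (x : Fin s → ℝ) :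
    conePiece b p x = |(Matrix.of b.vec).det|⁻¹ *
      (cone b.vec).indicator (fun x => MvPolynomial.eval (-x) p) x := by
  rw [conePiece, Set.indicator_const_mul]

lemma integrable_exp_mul_conePiece (b : NB a) (p : MvPolynomial (Fin s) ℝ) {u : Fin s → ℝ}
    (hu : ∀ i, 0 < b.vec i ⬝ᵥ u) :
    Integrable fun x => Real.exp (-(x ⬝ᵥ u)) * conePiece b p x := by
  have h1 : Integrable (fun x => Real.exp (-(x ⬝ᵥ u)) *
      (cone b.vec).indicator (fun x => MvPolynomial.eval (-x) p) x)
      ((volume : Measure (Fin s → ℝ)).map b.basis.equivFun.symm) := by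
    rw [b.measurableEmbedding.integrable_map_iff]
    simp only [Function.comp_def, conePiece_comp]
    exact (integrable_indicator_iff measurableSet_orthant).2
      (integrableOn_orthant_exp_mul_eval hu _)
  rw [b.map_volume, integrable_smul_measure (by simpa using b.det_ne_zero)
    ENNReal.ofReal_ne_top] at h1
  simp only [conePiece_eq, mul_left_comm _ (|(Matrix.of b.vec).det|⁻¹)]
  exact h1.const_mul _

/-- In the coordinates of `b` the cone is the orthant, and `|det b|⁻¹` is exactly the Jacobian
factor. -/
lemma integral_exp_mul_conePiece (b : NB a) (p : MvPolynomial (Fin s) ℝ) {u : Fin s → ℝ}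
    (hu : ∀ i, 0 < b.vec i ⬝ᵥ u) :
    ∫ x, Real.exp (-(x ⬝ᵥ u)) * conePiece b p x =
      fracEval b.vec (fun i => (b.vec i ⬝ᵥ u)⁻¹) p := by
  have h1 := b.measurableEmbedding.integral_map (μ := volume) (fun x => Real.exp (-(x ⬝ᵥ u)) *
      (cone b.vec).indicator (fun x => MvPolynomial.eval (-x) p) x)
  simp only [conePiece_comp] at h1
  rw [integral_indicator measurableSet_orthant, integral_orthant_exp_mul_eval hu, b.map_volume,
    integral_smul_measure, ENNReal.toReal_ofReal (by positivity)] at h1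
  simp only [conePiece_eq, mul_left_comm _ (|(Matrix.of b.vec).det|⁻¹)]
  rw [integral_const_mul, fracEval_apply, ← h1, smul_eq_mul]

/-- The exponential lacks compact support, so the identity of measures in `IsSplineDensity` is used
in place of the defining property of the spline. -/
lemma IsSplineDensity.laplace {T : (Fin s → ℝ) → ℝ} (hT : IsSplineDensity a T) {u : Fin s → ℝ}
    (hu : ∀ i, 0 < a i ⬝ᵥ u) :
    Integrable (fun x => Real.exp (-(x ⬝ᵥ u)) * T x) ∧
      ∫ x, Real.exp (-(x ⬝ᵥ u)) * T x = (dProd a u)⁻¹ := by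
  have hf : Continuous fun x : Fin s → ℝ => Real.exp (-(x ⬝ᵥ u)) :=
    Real.continuous_exp.comp (continuous_dotProduct_left u).neg
  have h1 : ∀ t : Fin N → ℝ, Real.exp (-((∑ i, t i • a i) ⬝ᵥ u)) =
      Real.exp (-∑ i, (a i ⬝ᵥ u) * t i) * MvPolynomial.eval (-t) 1 := by
    intro t
    rw [map_one, mul_one, sum_dotProduct]
    simp only [smul_dotProduct, smul_eq_mul, mul_comm]
  constructor
  · rw [hT.integrable_iff hf]
    simp only [h1]
    exact integrableOn_orthant_exp_mul_eval hu 1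
  · rw [hT.integral_eq hf]
    simp only [h1]
    rw [integral_orthant_exp_mul_eval hu]
    have : (1 : MvPolynomial (Fin N) ℝ) = MvPolynomial.monomial 0 1 := rfl
    rw [this, symbolEval_monomial]
    simp [invMonomial, dProd]

end LaplaceTransform

/-! ### Injectivity of the Laplace transform. -/

section Injectivity

variable {s N : ℕ} {a : Fin N → Fin s → ℝ}

/-- The bounded exponentials on the cone. -/
def expBounded (a : Fin N → Fin s → ℝ) {v : Fin s → ℝ} (hv : ∀ i, 0 ≤ a i ⬝ᵥ v) :
    BoundedContinuousFunction (cone a) ℝ :=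
  BoundedContinuousFunction.ofNormedAddCommGroup (fun x => Real.exp (-((x : Fin s → ℝ) ⬝ᵥ v)))
    (Real.continuous_exp.comp ((continuous_dotProduct_left v).comp continuous_subtype_val).neg) 1
    (fun x => by
      rw [Real.norm_eq_abs, Real.abs_exp, Real.exp_le_one_iff, neg_nonpos]
      exact dotProduct_nonneg_of_mem_cone hv x.2)

lemma expBounded_apply {v : Fin s → ℝ} (hv : ∀ i, 0 ≤ a i ⬝ᵥ v) (x : cone a) :
    expBounded a hv x = Real.exp (-((x : Fin s → ℝ) ⬝ᵥ v)) := rfl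

/-- The bounded exponentials on the cone form a monoid. -/
def expMonoid (a : Fin N → Fin s → ℝ) : Submonoid (BoundedContinuousFunction (cone a) ℝ) where
  carrier := {f | ∃ (v : Fin s → ℝ) (hv : ∀ i, 0 ≤ a i ⬝ᵥ v), f = expBounded a hv}
  one_mem' := ⟨0, fun i => by simp, by
    ext x
    rw [expBounded_apply]
    simp⟩
  mul_mem' := by
    rintro _ _ ⟨v, hv, rfl⟩ ⟨v', hv', rfl⟩
    refine ⟨v + v', fun i => ?_, ?_⟩
    · rw [dotProduct_add]
      exact add_nonneg (hv i) (hv' i)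
    · ext x
      rw [BoundedContinuousFunction.mul_apply, expBounded_apply, expBounded_apply,
        expBounded_apply, ← Real.exp_add, dotProduct_add, neg_add]

/-- The algebra spanned by the bounded exponentials on the cone. -/
def expAlgebra (a : Fin N → Fin s → ℝ) :
    StarSubalgebra ℝ (BoundedContinuousFunction (cone a) ℝ) :=
  { Algebra.adjoin ℝ (expMonoid a : Set (BoundedContinuousFunction (cone a) ℝ)) with
    star_mem' := by
      intro f hf
      have : star f = f := by
        ext x
        simp
      rwa [this] }

lemma mem_expAlgebra_iff (f : BoundedContinuousFunction (cone a) ℝ) :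
    f ∈ expAlgebra a ↔
      f ∈ Submodule.span ℝ (expMonoid a : Set (BoundedContinuousFunction (cone a) ℝ)) := by
  have h := Algebra.adjoin_eq_span ℝ (expMonoid a : Set (BoundedContinuousFunction (cone a) ℝ))
  rw [Submonoid.closure_eq] at h
  rw [← h]
  rfl

lemma isOpen_dotProduct_pos : IsOpen {u : Fin s → ℝ | ∀ i, 0 < a i ⬝ᵥ u} := by
  rw [Set.ofPred_forall]
  exact isOpen_iInter_of_finite fun i =>
    isOpen_lt continuous_const (continuous_dotProduct_right (a i))

/-- The admissible exponents include a neighbourhood of `u`, so comparing `u` with `u + ε e_j`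
recovers every coordinate of a point. -/
lemma separatesPoints_expAlgebra {u : Fin s → ℝ} (hu : ∀ i, 0 < a i ⬝ᵥ u) :
    ((expAlgebra a).map (BoundedContinuousFunction.toContinuousMapStarₐ ℝ)).SeparatesPoints := by
  intro x y hxy
  by_contra hcon
  have h1 : ∀ v : Fin s → ℝ, (∀ i, 0 ≤ a i ⬝ᵥ v) →
      (x : Fin s → ℝ) ⬝ᵥ v = (y : Fin s → ℝ) ⬝ᵥ v := by
    intro v hv
    by_contra hne
    apply hcon
    refine ⟨_, ⟨_, ⟨expBounded a hv, (mem_expAlgebra_iff _).2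
      (Submodule.subset_span ⟨v, hv, rfl⟩), rfl⟩, rfl⟩, ?_⟩
    intro h
    apply hne
    exact neg_injective (Real.exp_injective h)
  apply hxy
  ext j
  have h2 : ∀ᶠ ε : ℝ in 𝓝[≠] 0, ∀ i, 0 < a i ⬝ᵥ (u + ε • Pi.single j (1 : ℝ)) := by
    have hc : Continuous fun ε : ℝ => u + ε • (Pi.single j (1 : ℝ) : Fin s → ℝ) := by fun_prop
    refine Eventually.filter_mono nhdsWithin_le_nhds (hc.continuousAt.eventually
      (isOpen_dotProduct_pos.mem_nhds ?_))
    simpa using hu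
  obtain ⟨ε, hε, hε0⟩ := (h2.and self_mem_nhdsWithin).exists
  have h3 := h1 _ fun i => (hε i).le
  rw [dotProduct_add, dotProduct_add, h1 u fun i => (hu i).le, add_right_inj, dotProduct_smul,
    dotProduct_smul, smul_eq_mul, smul_eq_mul] at h3
  have h4 := mul_left_cancel₀ hε0 h3
  simpa using h4

/-- Injectivity of the Laplace transform for functions supported in a pointed cone. -/
lemma ae_eq_zero_of_laplace_eq_zero {u₀ : Fin s → ℝ} (hu₀ : ∀ i, 0 < a i ⬝ᵥ u₀)
    {G : (Fin s → ℝ) → ℝ} (hG : Measurable G) (hG0 : ∀ x, x ∉ cone a → G x = 0)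
    (hint : ∀ u : Fin s → ℝ, (∀ i, 0 < a i ⬝ᵥ u) →
      Integrable fun x => Real.exp (-(x ⬝ᵥ u)) * G x)
    (hzero : ∀ u : Fin s → ℝ, (∀ i, 0 < a i ⬝ᵥ u) →
      ∫ x, Real.exp (-(x ⬝ᵥ u)) * G x = 0) :
    G =ᵐ[volume] 0 := by
  have hclosed : IsClosed (cone a) := isClosed_cone hu₀
  have hmeas : MeasurableSet (cone a) := hclosed.measurableSet
  have : PolishSpace (cone a) := hclosed.polishSpace
  set ν : Measure (cone a) := (volume : Measure (Fin s → ℝ)).comap Subtype.val with hν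
  -- The weight at `u₀` makes `G` integrable; the transforms at `v + u₀` then become integrals of
  -- `g` against bounded exponentials.
  set g : cone a → ℝ := fun x => Real.exp (-((x : Fin s → ℝ) ⬝ᵥ u₀)) * G x with hg
  have hexp : ∀ u : Fin s → ℝ, Measurable fun x : Fin s → ℝ => Real.exp (-(x ⬝ᵥ u)) := fun u =>
    (Real.continuous_exp.comp (continuous_dotProduct_left u).neg).measurable
  have hgm : Measurable g := ((hexp u₀).mul hG).comp measurable_subtype_coe
  have hgi : Integrable g ν := by
    have := (integrableOn_iff_comap_subtypeVal hmeas).1 (hint u₀ hu₀).integrableOn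
    exact this
  have hfin : IsFiniteMeasure (ν.withDensity
      fun x => ENNReal.ofReal (g x)) := isFiniteMeasure_withDensity_ofReal hgi.2
  have hfin' : IsFiniteMeasure (ν.withDensity
      fun x => ENNReal.ofReal ((-g) x)) := isFiniteMeasure_withDensity_ofReal hgi.neg.2
  have hexpint : ∀ (v : Fin s → ℝ) (hv : ∀ i, 0 ≤ a i ⬝ᵥ v),
      ∫ x, expBounded a hv x * g x ∂ν = 0 := by
    intro v hv
    have hpos : ∀ i, 0 < a i ⬝ᵥ (v + u₀) := fun i => by
      rw [dotProduct_add]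
      exact add_pos_of_nonneg_of_pos (hv i) (hu₀ i)
    have h1 : ∀ x : cone a, expBounded a hv x * g x =
        (fun x : Fin s → ℝ => Real.exp (-(x ⬝ᵥ (v + u₀))) * G x) x := by
      intro x
      simp only [hg, expBounded_apply]
      rw [← mul_assoc, ← Real.exp_add, dotProduct_add, neg_add]
    simp only [h1]
    rw [hν, integral_subtype_comap hmeas (fun x : Fin s → ℝ => Real.exp (-(x ⬝ᵥ (v + u₀))) * G x),
      setIntegral_eq_integral_of_forall_compl_eq_zero, hzero _ hpos]
    intro x hx
    rw [hG0 x hx, mul_zero]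
  have hbint : ∀ φ : BoundedContinuousFunction (cone a) ℝ, Integrable (fun x => φ x * g x) ν :=
    fun φ => hgi.bdd_mul φ.continuous.aestronglyMeasurable
      (Eventually.of_forall fun x => φ.norm_coe_le_norm x)
  have halg : ∀ φ ∈ expAlgebra a, ∫ x, φ x * g x ∂ν = 0 := by
    intro φ hφ
    rw [mem_expAlgebra_iff] at hφ
    induction hφ using Submodule.span_induction with
    | mem f hf =>
      obtain ⟨v, hv, rfl⟩ := hf
      exact hexpint v hv
    | zero => simp
    | add f f' _ _ hf hf' =>
      simp only [BoundedContinuousFunction.add_apply, add_mul]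
      rw [integral_add (hbint f) (hbint f'), hf, hf', add_zero]
    | smul r f _ hf =>
      simp only [BoundedContinuousFunction.smul_apply, smul_eq_mul, mul_assoc]
      rw [integral_const_mul, hf, mul_zero]
  -- The positive and negative parts of `g` define finite measures with equal integrals on a
  -- separating algebra, hence equal measures.
  have hmeasure : ν.withDensity (fun x => ENNReal.ofReal (g x)) =
      ν.withDensity (fun x => ENNReal.ofReal ((-g) x)) := by
    refine ext_of_forall_mem_subalgebra_integral_eq_of_polish (𝕜 := ℝ)
      (separatesPoints_expAlgebra hu₀) fun φ hφ => ?_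
    rw [integral_withDensity_eq_integral_toReal_smul hgm.ennreal_ofReal
        (Eventually.of_forall fun x => ENNReal.ofReal_lt_top),
      integral_withDensity_eq_integral_toReal_smul hgm.neg.ennreal_ofReal
        (Eventually.of_forall fun x => ENNReal.ofReal_lt_top), ← sub_eq_zero, ← integral_sub]
    · rw [← halg φ hφ]
      refine integral_congr_ae (Eventually.of_forall fun x => ?_)
      simp only [ENNReal.toReal_ofReal', smul_eq_mul, Pi.neg_apply]
      rcases le_total 0 (g x) with h | h
      · rw [max_eq_left h, max_eq_right (by linarith)]
        ring
      · rw [max_eq_right h, max_eq_left (by linarith)]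
        ring
    · simp only [ENNReal.toReal_ofReal', smul_eq_mul, mul_comm _ (φ _)]
      exact hgi.pos_part.bdd_mul φ.continuous.aestronglyMeasurable
        (Eventually.of_forall fun x => φ.norm_coe_le_norm x)
    · simp only [ENNReal.toReal_ofReal', smul_eq_mul, mul_comm _ (φ _)]
      exact hgi.neg.pos_part.bdd_mul φ.continuous.aestronglyMeasurable
        (Eventually.of_forall fun x => φ.norm_coe_le_norm x)
  rw [withDensity_eq_iff hgm.ennreal_ofReal.aemeasurable hgm.neg.ennreal_ofReal.aemeasurable
    hgi.lintegral_lt_top.ne] at hmeasure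
  have hsub : ∀ᵐ x : cone a ∂ν, G x = 0 := by
    filter_upwards [hmeasure] with x hx
    have hgx : g x = 0 := by
      rcases lt_trichotomy (g x) 0 with h | h | h
      · rw [ENNReal.ofReal_of_nonpos h.le, eq_comm, ENNReal.ofReal_eq_zero, Pi.neg_apply] at hx
        linarith
      · exact h
      · rw [ENNReal.ofReal_of_nonpos (p := (-g) x) (by rw [Pi.neg_apply]; linarith),
          ENNReal.ofReal_eq_zero] at hx
        linarith
    exact (mul_eq_zero.1 hgx).resolve_left (Real.exp_pos _).ne'
  have hres : ∀ᵐ x ∂(volume.restrict (cone a)), G x = 0 := by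
    rw [← map_comap_subtype_coe hmeas, (MeasurableEmbedding.subtype_coe hmeas).ae_map_iff]
    exact hsub
  rw [ae_restrict_iff' hmeas] at hres
  filter_upwards [hres] with x hx
  by_cases h : x ∈ cone a
  · exact hx h
  · exact hG0 x h

end Injectivity

/-! ### From partial fractions to the formula on big cells, and back. -/

section LocalExpansion

variable {s N : ℕ} {a : Fin N → Fin s → ℝ}

/-- The piecewise polynomial function attached to a family of polynomials. -/
def pieceSum (p : NB a → MvPolynomial (Fin s) ℝ) (x : Fin s → ℝ) : ℝ :=
  ∑ b : NB a, conePiece b (p b) x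

lemma measurable_pieceSum (p : NB a → MvPolynomial (Fin s) ℝ) : Measurable (pieceSum p) :=
  Finset.measurable_sum _ fun b _ => measurable_conePiece b (p b)

lemma NB.cone_subset (b : NB a) : cone b.vec ⊆ cone a := cone_comp_subset a b.1

lemma pieceSum_eq_zero (p : NB a → MvPolynomial (Fin s) ℝ) {x : Fin s → ℝ}
    (hx : ∀ b : NB a, x ∉ cone b.vec) : pieceSum p x = 0 :=
  Finset.sum_eq_zero fun b _ => Set.indicator_of_notMem (hx b) _

lemma integrable_exp_mul_pieceSum (p : NB a → MvPolynomial (Fin s) ℝ) {u : Fin s → ℝ}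
    (hu : ∀ i, 0 < a i ⬝ᵥ u) : Integrable fun x => Real.exp (-(x ⬝ᵥ u)) * pieceSum p x := by
  simp only [pieceSum, Finset.mul_sum]
  exact integrable_finsetSum _ fun b _ => integrable_exp_mul_conePiece b (p b) fun i => hu _

lemma integral_exp_mul_pieceSum (p : NB a → MvPolynomial (Fin s) ℝ) {u : Fin s → ℝ}
    (hu : ∀ i, 0 < a i ⬝ᵥ u) :
    ∫ x, Real.exp (-(x ⬝ᵥ u)) * pieceSum p x =
      ∑ b, fracEval b.vec (fun i => (b.vec i ⬝ᵥ u)⁻¹) (p b) := by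
  simp only [pieceSum, Finset.mul_sum]
  rw [integral_finsetSum _ fun b _ => integrable_exp_mul_conePiece b (p b) fun i => hu _]
  exact Finset.sum_congr rfl fun b _ => integral_exp_mul_conePiece b (p b) fun i => hu _

lemma ae_eq_pieceSum {u₀ : Fin s → ℝ} (hu₀ : ∀ i, 0 < a i ⬝ᵥ u₀)
    {T : (Fin s → ℝ) → ℝ} (hT : IsSplineDensity a T) (hT0 : ∀ x, x ∉ cone a → T x = 0)
    {p : NB a → MvPolynomial (Fin s) ℝ} (hp : IsPartialFractionExpansion a p) :
    T =ᵐ[volume] pieceSum p := by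
  have h := ae_eq_zero_of_laplace_eq_zero hu₀ (G := fun x => T x - pieceSum p x)
    (hT.measurable.sub (measurable_pieceSum p)) (fun x hx => by
      rw [hT0 x hx, pieceSum_eq_zero p fun b hb => hx (b.cone_subset hb), sub_zero])
    (fun u hu => by
      simp only [mul_sub]
      exact (hT.laplace hu).1.sub (integrable_exp_mul_pieceSum p hu))
    (fun u hu => by
      simp only [mul_sub]
      rw [integral_sub (hT.laplace hu).1 (integrable_exp_mul_pieceSum p hu), (hT.laplace hu).2,
        integral_exp_mul_pieceSum p hu, hp.sum_fracEval u fun i => (hu i).ne', sub_self])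
  filter_upwards [h] with x hx
  exact sub_eq_zero.1 hx

/-- The cones of the no broken bases cover the cone of the family. -/
lemma exists_mem_cone {u₀ : Fin s → ℝ} (hu₀ : ∀ i, 0 < a i ⬝ᵥ u₀)
    {T : (Fin s → ℝ) → ℝ} (hT : IsSplineDensity a T) (hT0 : ∀ x, x ∉ cone a → T x = 0)
    {p : NB a → MvPolynomial (Fin s) ℝ} (hp : IsPartialFractionExpansion a p)
    {x : Fin s → ℝ} (hx : x ∈ cone a) : ∃ b : NB a, x ∈ cone b.vec := by
  by_contra! hcon
  have hφ := continuous_sum_smul a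
  -- `W` is open and `T` vanishes almost everywhere on it, so its preimage in the orthant is null
  -- and cannot meet the open orthant.
  set W : Set (Fin s → ℝ) := ⋂ b : NB a, (cone b.vec)ᶜ with hW
  have hWo : IsOpen W := isOpen_iInter_of_finite fun b => b.isClosed_cone.isOpen_compl
  have hxW : x ∈ W := Set.mem_iInter.2 hcon
  have h1 : (volume.restrict {t : Fin N → ℝ | ∀ i, 0 ≤ t i}).map (fun t => ∑ i, t i • a i) W
      = 0 := by
    rw [hT.map_eq, withDensity_apply _ hWo.measurableSet, setLIntegral_eq_zero_iff
      hWo.measurableSet hT.measurable.ennreal_ofReal]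
    filter_upwards [ae_eq_pieceSum hu₀ hT hT0 hp] with y hy hyW
    rw [hy, pieceSum_eq_zero p (Set.mem_iInter.1 hyW), ENNReal.ofReal_zero]
  rw [Measure.map_apply hφ.measurable hWo.measurableSet,
    Measure.restrict_apply (hφ.measurable hWo.measurableSet)] at h1
  have hpos : IsOpen {t : Fin N → ℝ | ∀ i, 0 < t i} := by
    rw [Set.ofPred_forall]
    exact isOpen_iInter_of_finite fun i => isOpen_lt continuous_const (continuous_apply i)
  have h2 : (fun t : Fin N → ℝ => ∑ i, t i • a i) ⁻¹' W ∩ {t | ∀ i, 0 < t i} = ∅ := by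
    refine ((hWo.preimage hφ).inter hpos).eq_empty_of_measure_zero (μ := volume)
      (measure_mono_null ?_ h1)
    exact fun t ht => ⟨ht.1, fun i => (ht.2 i).le⟩
  obtain ⟨t, ht, rfl⟩ := hx
  have h3 : ∀ᶠ ε : ℝ in 𝓝[>] 0, ∑ i, (t + fun _ => ε : Fin N → ℝ) i • a i ∈ W := by
    have hc : Continuous fun ε : ℝ => ∑ i, (t + fun _ => ε : Fin N → ℝ) i • a i :=
      hφ.comp (by fun_prop)
    refine Eventually.filter_mono nhdsWithin_le_nhds (hc.continuousAt.eventually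
      (hWo.mem_nhds ?_))
    simpa using hxW
  obtain ⟨ε, hε, hε0⟩ := (h3.and self_mem_nhdsWithin).exists
  have h4 : (t + fun _ => ε) ∈
      (fun t : Fin N → ℝ => ∑ i, t i • a i) ⁻¹' W ∩ {t | ∀ i, 0 < t i} :=
    ⟨hε, fun i => add_pos_of_nonneg_of_pos (ht i) hε0⟩
  rw [h2] at h4
  exact h4

lemma notMem_frontier_of_mem_regularPoints {x : Fin s → ℝ} (hx : x ∈ regularPoints a)
    (b : NB a) : x ∉ frontier (cone b.vec) :=
  fun h => hx.2 (Set.mem_iUnion.2 ⟨b, h⟩)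

lemma mem_interior_cone_of_mem_regularPoints {x : Fin s → ℝ} (hx : x ∈ regularPoints a)
    {b : NB a} (hb : x ∈ cone b.vec) : x ∈ interior (cone b.vec) := by
  by_contra h
  apply notMem_frontier_of_mem_regularPoints hx b
  rw [b.isClosed_cone.frontier_eq]
  exact ⟨hb, h⟩

lemma continuousOn_pieceSum (p : NB a → MvPolynomial (Fin s) ℝ) :
    ContinuousOn (pieceSum p) (regularPoints a) := by
  refine continuousOn_finsetSum _ fun b _ x hx => ContinuousAt.continuousWithinAt ?_
  exact ContinuousOn.continuousAt_indicator
    (continuous_const.mul (continuous_eval_neg _)).continuousOn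
    (notMem_frontier_of_mem_regularPoints hx b)

/-- No regular point is on the frontier, so the cone meets the regular points in a relatively clopen
set and a connected cell cannot be split. -/
lemma subset_cone_iff_of_isBigCell {c : Set (Fin s → ℝ)} (hc : IsBigCell a c) {x : Fin s → ℝ}
    (hx : x ∈ c) (b : NB a) : c ⊆ cone b.vec ↔ x ∈ cone b.vec := by
  refine ⟨fun h => h hx, fun hxb => ?_⟩
  obtain ⟨y, -, rfl⟩ := hc
  have hreg : connectedComponentIn (regularPoints a) y ⊆ regularPoints a :=
    connectedComponentIn_subset _ _
  refine Set.Subset.trans (isPreconnected_connectedComponentIn.subset_of_closure_inter_subset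
    isOpen_interior ⟨x, hx, mem_interior_cone_of_mem_regularPoints (hreg hx) hxb⟩ ?_)
    interior_subset
  rintro z ⟨hz, hzc⟩
  exact mem_interior_cone_of_mem_regularPoints (hreg hzc)
    (closure_minimal interior_subset b.isClosed_cone hz)

lemma pieceSum_eq_of_mem_isBigCell (p : NB a → MvPolynomial (Fin s) ℝ) {c : Set (Fin s → ℝ)}
    (hc : IsBigCell a c) {x : Fin s → ℝ} (hx : x ∈ c) :
    pieceSum p x = ∑ b : NB a with c ⊆ cone b.vec,
      |(Matrix.of b.vec).det|⁻¹ * MvPolynomial.eval (-x) (p b) := by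
  rw [pieceSum, Finset.sum_filter]
  refine Finset.sum_congr rfl fun b _ => ?_
  rw [conePiece, Set.indicator_apply]
  exact if_congr (subset_cone_iff_of_isBigCell hc hx b).symm rfl rfl

/-- Covering puts each regular point in some `cone b.vec`, off its frontier, hence in the interior
of `cone a`. -/
lemma isOpen_regularPoints (hcover : ∀ x ∈ cone a, ∃ b : NB a, x ∈ cone b.vec) :
    IsOpen (regularPoints a) := by
  have h1 : regularPoints a = interior (cone a) ∩ ⋂ b : NB a, (frontier (cone b.vec))ᶜ := by
    ext x
    constructor
    · intro hx
      obtain ⟨b, hb⟩ := hcover x hx.1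
      exact ⟨interior_mono b.cone_subset (mem_interior_cone_of_mem_regularPoints hx hb),
        Set.mem_iInter.2 fun b => notMem_frontier_of_mem_regularPoints hx b⟩
    · rintro ⟨hx, hx'⟩
      refine ⟨interior_subset hx, fun h => ?_⟩
      obtain ⟨b, hb⟩ := Set.mem_iUnion.1 h
      exact Set.mem_iInter.1 hx' b hb
  rw [h1]
  exact isOpen_interior.inter (isOpen_iInter_of_finite fun b => isClosed_frontier.isOpen_compl)

lemma eqOn_pieceSum (hcover : ∀ x ∈ cone a, ∃ b : NB a, x ∈ cone b.vec)
    {T : (Fin s → ℝ) → ℝ} (hT : ContinuousOn T (cone a)) {p : NB a → MvPolynomial (Fin s) ℝ}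
    (hp : T =ᵐ[volume] pieceSum p) : Set.EqOn T (pieceSum p) (regularPoints a) :=
  Measure.eqOn_open_of_ae_eq (ae_restrict_of_ae hp) (isOpen_regularPoints hcover)
    (hT.mono Set.sdiff_subset) (continuousOn_pieceSum p)

lemma isLocalExpansion_of_eqOn (hclosed : IsClosed (cone a)) {T : (Fin s → ℝ) → ℝ}
    (hT : ContinuousOn T (cone a)) {p : NB a → MvPolynomial (Fin s) ℝ}
    (hp : Set.EqOn T (pieceSum p) (regularPoints a)) : IsLocalExpansion a T p := by
  intro c hc
  have hreg : c ⊆ regularPoints a := by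
    obtain ⟨y, -, rfl⟩ := hc
    exact connectedComponentIn_subset _ _
  have h1 : Set.EqOn T (fun x => ∑ b : NB a with c ⊆ cone b.vec,
      |(Matrix.of b.vec).det|⁻¹ * MvPolynomial.eval (-x) (p b)) c := fun x hx => by
    rw [hp (hreg hx), pieceSum_eq_of_mem_isBigCell p hc hx]
  refine h1.of_subset_closure (hT.mono (closure_minimal (hreg.trans Set.sdiff_subset) hclosed)) ?_
    subset_closure subset_rfl
  exact (continuous_finsetSum _ fun b _ =>
    continuous_const.mul (continuous_eval_neg (p b))).continuousOn

lemma IsLocalExpansion.eqOn {T : (Fin s → ℝ) → ℝ} {q : NB a → MvPolynomial (Fin s) ℝ}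
    (hq : IsLocalExpansion a T q) : Set.EqOn T (pieceSum q) (regularPoints a) := by
  intro x hx
  have hc : IsBigCell a (connectedComponentIn (regularPoints a) x) := ⟨x, hx, rfl⟩
  have hxc := mem_connectedComponentIn hx
  rw [pieceSum_eq_of_mem_isBigCell q hc hxc]
  exact hq _ hc x (subset_closure hxc)

lemma ae_eq_of_eqOn_regularPoints {p q : NB a → MvPolynomial (Fin s) ℝ}
    (h : Set.EqOn (pieceSum p) (pieceSum q) (regularPoints a)) :
    pieceSum p =ᵐ[volume] pieceSum q := by
  have h1 : ∀ᵐ x : Fin s → ℝ, ∀ b : NB a, x ∉ frontier (cone b.vec) :=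
    ae_all_iff.2 fun b => measure_eq_zero_iff_ae_notMem.1
      ((convex_cone b.vec).addHaar_frontier volume)
  filter_upwards [h1] with x hx
  by_cases hxa : x ∈ cone a
  · exact h ⟨hxa, fun h => by
      obtain ⟨b, hb⟩ := Set.mem_iUnion.1 h
      exact hx b hb⟩
  · rw [pieceSum_eq_zero p fun b hb => hxa (b.cone_subset hb),
      pieceSum_eq_zero q fun b hb => hxa (b.cone_subset hb)]

/-- Both piecewise functions agree off the null frontiers, so their transforms agree. These are
available only for `u` positive on the family, which is why independence was proved over an
arbitrary nonempty open set. -/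
lemma IsLocalExpansion.unique {u₀ : Fin s → ℝ} (hu₀ : ∀ i, 0 < a i ⬝ᵥ u₀) {T : (Fin s → ℝ) → ℝ}
    {p q : NB a → MvPolynomial (Fin s) ℝ} (hp : IsLocalExpansion a T p)
    (hq : IsLocalExpansion a T q) : q = p := by
  have hae : pieceSum q =ᵐ[volume] pieceSum p :=
    ae_eq_of_eqOn_regularPoints fun x hx => (hq.eqOn hx).symm.trans (hp.eqOn hx)
  rw [← sub_eq_zero]
  refine eq_zero_of_sum_fracEval_eq_zero (O := {u | ∀ i, 0 < a i ⬝ᵥ u}) (fun i h => ?_)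
    isOpen_dotProduct_pos ⟨u₀, hu₀⟩ (fun u hu i => (hu i).ne') _ fun u hu => ?_
  · have := hu₀ i
    rw [h, zero_dotProduct] at this
    exact lt_irrefl _ this
  · simp only [Pi.sub_apply, map_sub, Finset.sum_sub_distrib]
    rw [← integral_exp_mul_pieceSum p hu, ← integral_exp_mul_pieceSum q hu, sub_eq_zero]
    refine integral_congr_ae ?_
    filter_upwards [hae] with x hx
    rw [hx]

end LocalExpansion

end Spline

end

theorem mainTheorem4 {s N : ℕ} (a : Fin N → Fin s → ℝ)
    (hspan : Submodule.span ℝ (Set.range a) = ⊤)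
    (h0 : (0 : Fin s → ℝ) ∉ convexHull ℝ (Set.range a)) :
    (∃! T : (Fin s → ℝ) → ℝ, Spline.IsMultivariateSpline a T) ∧
    ∃ p : Spline.NB a → MvPolynomial (Fin s) ℝ,
      (∀ b, (p b).IsHomogeneous (N - s) ∧ p b ∈ Spline.spaceD a) ∧
      Spline.IsPartialFractionExpansion a p ∧
      (∀ q : Spline.NB a → MvPolynomial (Fin s) ℝ,
        Spline.IsPartialFractionExpansion a q → q = p) ∧
      ∀ T : (Fin s → ℝ) → ℝ, Spline.IsMultivariateSpline a T →
        Spline.IsLocalExpansion a T p ∧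
        ∀ q : Spline.NB a → MvPolynomial (Fin s) ℝ,
          Spline.IsLocalExpansion a T q → q = p := by
  obtain ⟨u₀, hu₀⟩ := Spline.exists_forall_dotProduct_pos h0
  have ha : ∀ i, a i ≠ 0 := fun i h => by
    have := hu₀ i
    rw [h, zero_dotProduct] at this
    exact lt_irrefl _ this
  have hclosed : IsClosed (Spline.cone a) := Spline.isClosed_cone hu₀
  obtain ⟨b⟩ := Spline.nonempty_NB ha hspan
  obtain ⟨T, hT0, hTc, hT⟩ := Spline.exists_isSplineDensity b.basis b.1.toEmbedding
    (fun j => by rw [Spline.NB.coe_basis]; rfl) hu₀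
  have hTs := hT.isMultivariateSpline hT0 hTc
  obtain ⟨p, hph, hp⟩ := Spline.exists_isPartialFractionExpansion hspan
  refine ⟨⟨T, hTs, fun T' hT' => hT'.unique b hclosed hTs⟩, p,
    fun b => ⟨hph b, hp.mem_spaceD ha b⟩, hp, fun q hq => hp.unique ha hq, fun T' hT' => ?_⟩
  obtain rfl := hT'.unique b hclosed hTs
  have hloc : Spline.IsLocalExpansion a T' p :=
    Spline.isLocalExpansion_of_eqOn hclosed hTc (Spline.eqOn_pieceSum
      (fun x hx => Spline.exists_mem_cone hu₀ hT hT0 hp hx) hTc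
      (Spline.ae_eq_pieceSum hu₀ hT hT0 hp))
  exact ⟨hloc, fun q hq => hloc.unique hu₀ hq⟩
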